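/- Let $n$ be a positive integer. Let $\tilde S_n$ be the Coxeter group with simple generators $s_0,s_1,\dots,s_{n-1}$ whose Coxeter diagram is the $n$-cycle $s_0 - s_1 - \cdots - s_{n-1} - s_0$ if $n\ge 3$; let $\tilde S_2$ be the infinite dihedral group generated by $s_0,s_1$, and let $\tilde S_1=\{1\}$ (with no generators). Let $\ell$ be its length function, put $S=\{s_1,\dots,s_{n-1}\}$, and let $S_n=\langle S\rangle$ be the corresponding finite parabolic subgroup, with Poincaré polynomial $P_{S_n}(q)=\sum_{w\in S_n}q^{\ell(w)}$. Let $\ell'$ be the absolute length function on $\mathbf I=\{w\in\tilde S_n: w=w^{-1}\}$, that is, the unique map $\mathbf I\to\mathbb N$ such that $\ell'(1)=0$; $\ell'(sws)=\ell'(w)$ for every simple generator $s$ and every $w\in\mathbf I$; and $\ell'(ws)-\ell'(w)=\ell(ws)-\ell(w)$ whenever $s$ is a simple generator and $w,ws\in\mathbf I$. For $w\in\mathbf I$ let $\diamond$ be the automorphism $x\mapsto wxw$ of $\tilde S_n$, let $K=S\cap wSw$, and let $$F_{K,\diamond}(q)=\sum_{x\in\langle K\rangle,\ wxw=x}q^{\ell(x)}.$$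 Write $[m]_q=\frac{1-q^m}{1-q}$, $[m]_q!=\prod_{i=1}^m[i]_q$, $\binom{m}{j}_q=\frac{[m]_q!}{[j]_q!\,[m-j]_q!}$ for $0\le j\le m$, and $(a;q)_m=\prod_{i=0}^{m-1}(1-aq^i)$. Then for every integer $k$ with $0\le k\le\lfloor n/2\rfloor$, the following identity of formal power series holds in $\mathbb Z[[q]]$: $$\sum_{w} q^{\ell(w)}\,\frac{P_{S_n}(q^2)}{F_{K,\diamond}(q)} = q^{k^2}\cdot\frac{[n]_q}{[2n-2k]_q}\cdot\binom{n-k}{k}_q\cdot(-q^{k+1};q)_{n-2k}\cdot\left(\frac{1+q}{1-q}\right)^k\cdot\frac{1+q^n}{(1+q)^n},$$ where the sum is over all $w\in\mathbf I$ with $\ell'(w)=k$ and $\ell(ws)>\ell(w)$ for all $s\in S$ (equivalently, over the elements of $\mathbf I$ of absolute length $k$ which have minimal length in their $(S_n,S_n)$-double coset), and $\diamond$ and $K$ are those attached to $w$. -/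

import Mathlib

open PowerSeries
open scoped PowerSeries.WithPiTopology

noncomputable section

namespace CoxeterInvolutions

/-! ### Coxeter systems: involutions, absolute length, minimal coset representatives -/

section General

variable {B W : Type*} [Group W] {M : CoxeterMatrix B} (cs : CoxeterSystem M W)

/-- The set of `w` with `w = w⁻¹` (so the identity is included). -/
def involutions (W : Type*) [Group W] : Set W := {w | w⁻¹ = w}

/-- The absolute length function on the involutions of `W`, through its defining properties:
it vanishes at `1`, it is invariant under conjugation by simple generators, and it changes exactly
as the length does when an involution `w` is multiplied by a simple generator `s` such that `w * s`
is again an involution. -/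
structure IsAbsoluteLength (ell' : involutions W → ℕ) : Prop where
  one : ∀ w : involutions W, (w : W) = 1 → ell' w = 0
  conj : ∀ (i : B) (w v : involutions W),
    (v : W) = cs.simple i * w * cs.simple i → ell' v = ell' w
  mul : ∀ (i : B) (w v : involutions W), (v : W) = w * cs.simple i →
    (ell' v : ℤ) - ell' w = (cs.length (v : W) : ℤ) - cs.length (w : W)

/-- For a set `J` of simple generators, the minimal length representatives of the left cosets
of the standard parabolic subgroup generated by `J`. -/
def minCosetReps (J : Set W) : Set W := {w | ∀ s ∈ J, cs.length w < cs.length (w * s)}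

/-- The set `K = J ∩ w J w⁻¹`. -/
def interConj (J : Set W) (w : W) : Set W := J ∩ MulAut.conj w '' J

/-- The length generating function `∑ q ^ ℓ(w)` over `w ∈ A`, as a formal power series. -/
def lengthSeries (A : Set W) : ℤ⟦X⟧ :=
  PowerSeries.mk fun m => (Nat.card {w : W // w ∈ A ∧ cs.length w = m} : ℤ)

/-- The Poincaré series `P_J(q)` of the standard parabolic subgroup generated by `J`. -/
def poincareSeries (J : Set W) : ℤ⟦X⟧ :=
  lengthSeries cs (Subgroup.closure J : Set W)

/-- The length generating function `F_{K,d}(q)` of the fixed points of the automorphism `d`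
in the standard parabolic subgroup generated by `K`. -/
def fixedSeries (K : Set W) (d : MulAut W) : ℤ⟦X⟧ :=
  lengthSeries cs {x | x ∈ Subgroup.closure K ∧ d x = x}

/-- The term `q ^ ℓ(w) * P_J(q ^ 2) / F_{K,d}(q)`, for `d` the conjugation by `w` and
`K = J ∩ w J w⁻¹`. -/
def cosetTerm (J : Set W) (w : W) : ℤ⟦X⟧ :=
  X ^ cs.length w * (PowerSeries.subst (X ^ 2 : ℤ⟦X⟧) (poincareSeries cs J) *
    Ring.inverse (fixedSeries cs (interConj J w) (MulAut.conj w)))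

/-- There are finitely many elements of a given length if there are finitely many generators, so
that `lengthSeries` really counts. -/
theorem finite_length_eq [Finite B] (m : ℕ) : {w : W | cs.length w = m}.Finite := by
  refine ((List.finite_length_eq B m).image cs.wordProd).subset ?_
  rintro w rfl
  obtain ⟨ω, hω, rfl⟩ := cs.exists_isReduced w
  exact ⟨ω, hω.symm, rfl⟩

/-- A fixed point series is invertible in `ℤ⟦X⟧`, so that the division in `cosetTerm` is honest. -/
theorem isUnit_fixedSeries (K : Set W) (d : MulAut W) : IsUnit (fixedSeries cs K d) := by
  rw [PowerSeries.isUnit_iff_constantCoeff, ← PowerSeries.coeff_zero_eq_constantCoeff_apply]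
  have h : Nat.card {w : W // w ∈ {x | x ∈ Subgroup.closure K ∧ d x = x} ∧ cs.length w = 0} = 1 := by
    rw [Nat.card_eq_one_iff_unique]
    refine ⟨⟨fun a b => Subtype.ext ?_⟩, ⟨⟨1, ⟨one_mem _, map_one d⟩, cs.length_one⟩⟩⟩
    rw [cs.length_eq_zero_iff.1 a.2.2, cs.length_eq_zero_iff.1 b.2.2]
  simp only [fixedSeries, lengthSeries, PowerSeries.coeff_mk, h]
  simp

end General

/-! ### The affine Coxeter group of type `A` -/

/-- The index set `{0, 1, …, n - 1}` of the simple generators for `n ≥ 2`; it is empty for `n = 1`,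
where the group is trivial. -/
abbrev AffineIndex (n : ℕ) : Type := {_i : Fin n // 2 ≤ n}

/-- The Coxeter matrix with diagram the cycle `0 - 1 - ⋯ - (n - 1) - 0` for `n ≥ 3`, that of the
infinite dihedral group for `n = 2` (the entry `0` stands for `∞`), and the empty one for `n = 1`. -/
def affineMatrix (n : ℕ) : CoxeterMatrix (AffineIndex n) where
  M := Matrix.of fun i j =>
    if i = j then 1
    else if n = 2 then 0
    else if ((i.1 : ℕ) + 1) % n = j.1 ∨ ((j.1 : ℕ) + 1) % n = i.1 then 3
    else 2
  isSymm := by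
    ext i j
    simp only [Matrix.transpose_apply, Matrix.of_apply, eq_comm (a := j) (b := i),
      or_comm (a := ((j.1 : ℕ) + 1) % n = i.1)]
  diagonal := by simp
  off_diagonal := by
    intro i j h
    simp only [Matrix.of_apply, if_neg h]
    split_ifs <;> decide

/-- The simple generators `s_1, …, s_{n-1}`, which generate the finite parabolic subgroup `S_n`. -/
def finiteGenerators {n : ℕ} {W : Type*} [Group W] (cs : CoxeterSystem (affineMatrix n) W) :
    Set W :=
  {s | ∃ i : AffineIndex n, (i.1 : ℕ) ≠ 0 ∧ s = cs.simple i}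

/-! ### `q`-numbers, as elements of `ℤ⟦X⟧` with `q = X` -/

/-- `[n]_q = (1 - q ^ n) / (1 - q)`. -/
def qNum (n : ℕ) : ℤ⟦X⟧ := (1 - X ^ n) * Ring.inverse (1 - X)

/-- `[n]_q! = [1]_q [2]_q ⋯ [n]_q`. -/
def qFactorial (n : ℕ) : ℤ⟦X⟧ := ∏ i ∈ Finset.Icc 1 n, qNum i

/-- The `q`-binomial coefficient, for `k ≤ n`. -/
def qBinom (n k : ℕ) : ℤ⟦X⟧ := qFactorial n * Ring.inverse (qFactorial k * qFactorial (n - k))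

/-- `(a; q)_n = (1 - a) (1 - a q) ⋯ (1 - a q ^ (n - 1))`. -/
def qPochhammer (a : ℤ⟦X⟧) (n : ℕ) : ℤ⟦X⟧ := ∏ i ∈ Finset.range n, (1 - a * X ^ i)

end CoxeterInvolutions

end

/-!
The group acts faithfully on `ℤ`: the generator `s_i` swaps `x - 1` and `x` for all `x ≡ i` modulo
`n`. The image consists of the permutations which commute with the translation by `n` and have total
displacement zero over a period (`toPerm_injective`, `exists_toPerm_eq`). A generator `s_i`
lengthens `w` exactly if `w (i - 1) < w i` (`length_lt_iff`), and the length is given by Shi's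
formula (`two_mul_length`). The absolute length of an involution is the number of two-element
orbits which it has on the residue classes: a class which is mapped to itself is fixed pointwise,
because a nontrivial translation has infinite order.

An involution `w` of minimal length in its double coset is increasing on the window
`{0, …, n - 1}`. Call `⌊w i / n⌋` the level of `i`. The levels increase along the window, `w`
matches the elements of level `l` with those of level `-l` in increasing order, and its fixed points
in the window are the elements of level `0`. So `w` is determined by its profile, the sequence whose
`j`-th term `r j` counts the elements of level less than `-j`. All nonincreasing sequences
occur which are eventually zero and have `r 0` equal to the absolute length `k ≤ n / 2` (`profileEquiv`).
A layer cake summation turns Shi's formula into `ℓ(w) = k ^ 2 + 2 ∑ (n - r j) (r (j + 1))`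
(`IsMinInvolution.shiSum_eq_profile`). The set `K` consists of the generators which exchange
neighbours on the same level, and conjugation by `w` exchanges the symmetric groups of opposite
levels and fixes that of level `0`; hence the fixed point series is `[n - 2 k]_q!` times the product
of the `[r j - r (j + 1)]_{q ^ 2}!` (`fixedSeries_eq`), as the generating function of inversions on
`m` letters is `[m]_q!`.

Thus the sum is, up to a factor which depends only on `n` and `k`, the sum `C k` over the profiles
of a product of weights of consecutive terms. Splitting off the first term gives a recursion
`C k = ∑_{i ≤ k} stepWeight n k i * C i` (`tsum_profileWeight_eq`). Its solution
(`tsum_profileWeight_mul`) comes from the identity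
`∑_i [k choose i]_p x ^ i (1 - x) (1 - x p) ⋯ (1 - x p ^ (k - i - 1)) = 1`
at `p = q ^ 2` and `x = p ^ (n - k)` (`sum_gaussBinom_mul_shiftedProd`). The rest is a comparison of
products of factors `1 ± q ^ i` (`closedForm_eq`).
-/

namespace CoxeterInvolutions

open Equiv

/-! ### The action of the affine group on the integers -/

section Swap

variable {n : ℕ}

theorem zmod_one_ne_zero (hn : 2 ≤ n) : (1 : ZMod n) ≠ 0 := by
  have : Fact (1 < n) := ⟨hn⟩
  exact one_ne_zero

theorem zmod_two_ne_zero (hn : 3 ≤ n) : (2 : ZMod n) ≠ 0 := by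
  intro h
  have h2 : ((2 : ℕ) : ZMod n) = 0 := by exact_mod_cast h
  rw [ZMod.natCast_eq_zero_iff] at h2
  exact absurd (Nat.le_of_dvd (by norm_num) h2) (by omega)

/-- The function underlying `affineSwap`. -/
def swapFun (i : ZMod n) (x : ℤ) : ℤ :=
  if (x : ZMod n) = i then x - 1 else if (x : ZMod n) + 1 = i then x + 1 else x

theorem swapFun_of_eq {i : ZMod n} {x : ℤ} (h : (x : ZMod n) = i) : swapFun i x = x - 1 := by
  simp [swapFun, h]

theorem swapFun_of_add_one_eq (hn : 2 ≤ n) {i : ZMod n} {x : ℤ} (h : (x : ZMod n) + 1 = i) :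
    swapFun i x = x + 1 := by
  have h1 := zmod_one_ne_zero hn
  have : (x : ZMod n) ≠ i := by
    rintro rfl
    exact h1 (by simpa using h)
  simp [swapFun, h, this]

theorem swapFun_of_ne {i : ZMod n} {x : ℤ} (h : (x : ZMod n) ≠ i) (h' : (x : ZMod n) + 1 ≠ i) :
    swapFun i x = x := by
  simp [swapFun, h, h']

theorem swapFun_involutive (hn : 2 ≤ n) (i : ZMod n) : Function.Involutive (swapFun i) := by
  intro x
  by_cases h : (x : ZMod n) = i
  · rw [swapFun_of_eq h, swapFun_of_add_one_eq hn (by push_cast; rw [h]; ring)]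
    ring
  · by_cases h' : (x : ZMod n) + 1 = i
    · rw [swapFun_of_add_one_eq hn h', swapFun_of_eq (by push_cast; rw [h'])]
      ring
    · rw [swapFun_of_ne h h', swapFun_of_ne h h']

/-- The permutation of `ℤ` which swaps `x - 1` and `x` for all `x` in the residue class `i`. -/
def affineSwap (hn : 2 ≤ n) (i : ZMod n) : Perm ℤ := (swapFun_involutive hn i).toPerm

@[simp] theorem affineSwap_apply (hn : 2 ≤ n) (i : ZMod n) (x : ℤ) :
    affineSwap hn i x = swapFun i x := rfl

theorem affineSwap_mul_self (hn : 2 ≤ n) (i : ZMod n) :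
    affineSwap hn i * affineSwap hn i = 1 := by
  ext x
  simp [swapFun_involutive hn i x]

/-- A permutation of `ℤ` which commutes with the translation by `n`. -/
def IsPeriodic (n : ℕ) (u : Perm ℤ) : Prop := ∀ x, u (x + n) = u x + n

theorem IsPeriodic.add_mul {u : Perm ℤ} (hu : IsPeriodic n u) (x k : ℤ) :
    u (x + n * k) = u x + n * k := by
  induction k using Int.induction_on with
  | zero => simp
  | succ k ih => rw [mul_add, mul_one, ← add_assoc, hu, ih]; ring
  | pred k ih =>
    have := hu (x + n * (-k - 1))
    rw [show x + n * (-k - 1) + n = x + (n : ℤ) * -k by ring, ih] at this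
    linarith

theorem isPeriodic_one : IsPeriodic n 1 := fun _ => rfl

theorem IsPeriodic.mul {u v : Perm ℤ} (hu : IsPeriodic n u) (hv : IsPeriodic n v) :
    IsPeriodic n (u * v) := fun x => by
  rw [Perm.mul_apply, hv, hu, Perm.mul_apply]

theorem isPeriodic_affineSwap (hn : 2 ≤ n) (i : ZMod n) : IsPeriodic n (affineSwap hn i) := by
  intro x
  simp only [affineSwap_apply, swapFun]
  push_cast
  simp only [CharP.cast_eq_zero, add_zero]
  split_ifs <;> ring

theorem exists_eq_add_mul {x y : ℤ} (h : (x : ZMod n) = y) : ∃ k, y = x + n * k := by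
  obtain ⟨k, hk⟩ := (ZMod.intCast_eq_intCast_iff_dvd_sub x y n).1 h
  exact ⟨k, by linarith⟩

theorem IsPeriodic.cast_eq {u : Perm ℤ} (hu : IsPeriodic n u) {x y : ℤ}
    (h : (x : ZMod n) = y) : ((u x : ℤ) : ZMod n) = u y := by
  obtain ⟨k, rfl⟩ := exists_eq_add_mul h
  rw [hu.add_mul]
  simp

theorem IsPeriodic.inv {u : Perm ℤ} (hu : IsPeriodic n u) : IsPeriodic n u⁻¹ := by
  intro x
  rw [Perm.inv_eq_iff_eq, hu]
  simp

theorem IsPeriodic.cast_injective {u : Perm ℤ} (hu : IsPeriodic n u) {x y : ℤ}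
    (h : ((u x : ℤ) : ZMod n) = u y) : (x : ZMod n) = y := by
  simpa using hu.inv.cast_eq h

/-- Being increasing at a position depends only on its residue class. -/
theorem IsPeriodic.lt_iff {u : Perm ℤ} (hu : IsPeriodic n u) {x y : ℤ}
    (h : (x : ZMod n) = y) : u (x - 1) < u x ↔ u (y - 1) < u y := by
  obtain ⟨k, rfl⟩ := exists_eq_add_mul h
  rw [show x + n * k - 1 = x - 1 + n * k by ring, hu.add_mul, hu.add_mul]
  simp

end Swap

section Hom

variable {n : ℕ}

theorem affineMatrix_apply (i j : AffineIndex n) : affineMatrix n i j =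
    if i = j then 1
    else if n = 2 then 0
    else if ((i.1 : ℕ) : ZMod n) + 1 = (j.1 : ℕ) ∨ ((j.1 : ℕ) : ZMod n) + 1 = (i.1 : ℕ) then 3
    else 2 := by
  have h : ∀ i j : AffineIndex n,
      ((i.1 : ℕ) : ZMod n) + 1 = (j.1 : ℕ) ↔ ((i.1 : ℕ) + 1) % n = j.1 := by
    intro i j
    rw [← Nat.cast_add_one, ZMod.natCast_eq_natCast_iff', Nat.mod_eq_of_lt j.1.2]
  simp only [h]
  rfl

theorem affineIndex_ext {i j : AffineIndex n}
    (h : ((i.1 : ℕ) : ZMod n) = ((j.1 : ℕ) : ZMod n)) : i = j := by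
  rw [ZMod.natCast_eq_natCast_iff', Nat.mod_eq_of_lt i.1.2, Nat.mod_eq_of_lt j.1.2] at h
  exact Subtype.ext (Fin.ext h)

/-- The index of the simple generator attached to a residue class. -/
def residueIndex (hn : 2 ≤ n) (z : ZMod n) : AffineIndex n :=
  ⟨⟨z.val, have : NeZero n := ⟨by omega⟩; z.val_lt⟩, hn⟩

theorem cast_residueIndex (hn : 2 ≤ n) (z : ZMod n) :
    (((residueIndex hn z).1 : ℕ) : ZMod n) = z := by
  have : NeZero n := ⟨by omega⟩
  simp [residueIndex]

/-- In type `A` with at least three generators, neighbouring swaps satisfy the braid relation. -/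
theorem affineSwap_braid (hn : 3 ≤ n) (hn' : 2 ≤ n) (i j : ZMod n) (h : i + 1 = j) :
    (affineSwap hn' i * affineSwap hn' j) ^ 3 = 1 := by
  have h1 := zmod_one_ne_zero hn'
  have h2 := zmod_two_ne_zero hn
  subst h
  have e1 : ∀ x : ℤ, (x : ZMod n) = i + 1 →
      affineSwap hn' i (affineSwap hn' (i + 1) x) = x - 2 := by
    intro x hx
    simp only [affineSwap_apply]
    rw [swapFun_of_eq hx, swapFun_of_eq (by push_cast; rw [hx]; ring)]
    ring
  have e2 : ∀ x : ℤ, (x : ZMod n) = i → affineSwap hn' i (affineSwap hn' (i + 1) x) = x + 1 := by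
    intro x hx
    simp only [affineSwap_apply]
    rw [swapFun_of_add_one_eq hn' (i := i + 1) (by rw [hx]), swapFun_of_ne]
    · push_cast; rw [hx]; simpa using h1
    · push_cast; rw [hx]
      intro h
      apply h2
      linear_combination h
  have e3 : ∀ x : ℤ, (x : ZMod n) = i - 1 →
      affineSwap hn' i (affineSwap hn' (i + 1) x) = x + 1 := by
    intro x hx
    simp only [affineSwap_apply]
    rw [swapFun_of_ne (x := x) (i := i + 1), swapFun_of_add_one_eq hn']
    · rw [hx]; ring
    · rw [hx]
      intro h
      apply h2
      linear_combination -h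
    · rw [hx]
      intro h
      apply h1
      linear_combination -h
  have e4 : ∀ x : ℤ, (x : ZMod n) ≠ i + 1 → (x : ZMod n) ≠ i → (x : ZMod n) ≠ i - 1 →
      affineSwap hn' i (affineSwap hn' (i + 1) x) = x := by
    intro x hx hx' hx''
    simp only [affineSwap_apply]
    rw [swapFun_of_ne (x := x) (i := i + 1) hx (by simpa using hx'), swapFun_of_ne hx']
    intro h
    apply hx''
    linear_combination h
  ext x
  simp only [pow_succ, pow_zero, one_mul, Perm.mul_apply, Perm.one_apply]
  by_cases hx : (x : ZMod n) = i + 1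
  · rw [e1 x hx, e3 (x - 2) (by push_cast; rw [hx]; ring), e2 _ (by push_cast; rw [hx]; ring)]
    ring
  · by_cases hx' : (x : ZMod n) = i
    · rw [e2 x hx', e1 (x + 1) (by push_cast; rw [hx']), e3 _ (by push_cast; rw [hx']; ring)]
      ring
    · by_cases hx'' : (x : ZMod n) = i - 1
      · rw [e3 x hx'', e2 (x + 1) (by push_cast; rw [hx'']; ring),
          e1 _ (by push_cast; rw [hx'']; ring)]
        ring
      · rw [e4 x hx hx' hx'', e4 x hx hx' hx'', e4 x hx hx' hx'']

theorem affineSwap_comm (hn : 2 ≤ n) (i j : ZMod n) (hij : i ≠ j) (h : i + 1 ≠ j)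
    (h' : j + 1 ≠ i) : affineSwap hn i * affineSwap hn j = affineSwap hn j * affineSwap hn i := by
  have h1 := zmod_one_ne_zero hn
  have key : ∀ i j : ZMod n, i ≠ j → i + 1 ≠ j → j + 1 ≠ i → ∀ x : ℤ,
      ((x : ZMod n) = i ∨ (x : ZMod n) + 1 = i) →
      swapFun i (swapFun j x) = swapFun j (swapFun i x) := by
    intro i j hij h h' x hx
    have hj : swapFun j x = x := by
      apply swapFun_of_ne
      · rintro rfl
        rcases hx with rfl | rfl
        · exact hij rfl
        · exact h' rfl
      · rintro rfl
        rcases hx with rfl | rfl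
        · exact h rfl
        · exact hij rfl
    rw [hj, eq_comm]
    rcases hx with rfl | rfl
    · rw [swapFun_of_eq rfl]
      apply swapFun_of_ne
      · push_cast
        rintro rfl
        exact h' (by ring)
      · push_cast
        rintro rfl
        exact hij (by ring)
    · rw [swapFun_of_add_one_eq hn rfl]
      apply swapFun_of_ne
      · push_cast
        rintro rfl
        exact hij rfl
      · push_cast
        exact h
  ext x
  simp only [Perm.mul_apply, affineSwap_apply]
  by_cases hx : (x : ZMod n) = i ∨ (x : ZMod n) + 1 = i
  · exact key i j hij h h' x hx
  · by_cases hx' : (x : ZMod n) = j ∨ (x : ZMod n) + 1 = j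
    · exact (key j i hij.symm h' h x hx').symm
    · push Not at hx hx'
      rw [swapFun_of_ne hx.1 hx.2, swapFun_of_ne hx'.1 hx'.2, swapFun_of_ne hx.1 hx.2]

theorem isLiftable_affineSwap :
    (affineMatrix n).IsLiftable fun i => affineSwap i.2 ((i.1 : ℕ) : ZMod n) := by
  intro i j
  rw [affineMatrix_apply]
  split_ifs with h h2 h3
  · subst h
    rw [pow_one, affineSwap_mul_self]
  · rw [pow_zero]
  · have hn : 3 ≤ n := by have := i.2; omega
    rcases h3 with h3 | h3
    · exact affineSwap_braid hn i.2 _ _ h3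
    · have := affineSwap_braid hn i.2 _ _ h3
      rw [← inv_inj, ← inv_pow, mul_inv_rev, inv_one]
      rwa [inv_eq_of_mul_eq_one_left (affineSwap_mul_self i.2 _),
        inv_eq_of_mul_eq_one_left (affineSwap_mul_self i.2 _)]
  · push Not at h3
    have hij : ((i.1 : ℕ) : ZMod n) ≠ ((j.1 : ℕ) : ZMod n) := fun h' => h (affineIndex_ext h')
    rw [pow_two]
    nth_rewrite 2 [affineSwap_comm i.2 _ _ hij h3.1 h3.2]
    rw [mul_assoc, ← mul_assoc (affineSwap _ _) (affineSwap _ _) (affineSwap _ _),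
      affineSwap_mul_self, one_mul, affineSwap_mul_self]

variable {W : Type*} [Group W] (cs : CoxeterSystem (affineMatrix n) W)

/-- The action of the affine group on `ℤ`, in which the generator `s_i` swaps `x - 1` and `x`
for all `x` congruent to `i` modulo `n`. -/
noncomputable def toPerm : W →* Perm ℤ := cs.lift ⟨_, isLiftable_affineSwap⟩

theorem toPerm_simple (i : AffineIndex n) :
    toPerm cs (cs.simple i) = affineSwap i.2 ((i.1 : ℕ) : ZMod n) :=
  cs.lift_apply_simple isLiftable_affineSwap i

theorem isPeriodic_toPerm (w : W) : IsPeriodic n (toPerm cs w) := by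
  induction w using cs.simple_induction_right with
  | one => rw [map_one]; exact isPeriodic_one
  | mul_simple_right w i ih =>
    rw [map_mul, toPerm_simple]
    exact ih.mul (isPeriodic_affineSwap _ _)

theorem toPerm_mul_simple_apply (w : W) (i : AffineIndex n) (x : ℤ) :
    toPerm cs (w * cs.simple i) x = toPerm cs w (swapFun ((i.1 : ℕ) : ZMod n) x) := by
  rw [map_mul, toPerm_simple]
  rfl

theorem simple_commute {i j : AffineIndex n} (h : affineMatrix n i j = 2) :
    cs.simple i * cs.simple j = cs.simple j * cs.simple i := by
  have := cs.simple_mul_simple_pow i j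
  rw [h, pow_two] at this
  rw [eq_inv_of_mul_eq_one_left this, mul_inv_rev, cs.inv_simple, cs.inv_simple]

theorem simple_braid {i j : AffineIndex n} (h : affineMatrix n i j = 3) :
    cs.simple i * cs.simple j * cs.simple i = cs.simple j * cs.simple i * cs.simple j := by
  have := cs.simple_mul_simple_pow i j
  rw [h, pow_succ, pow_two] at this
  have h' := eq_inv_of_mul_eq_one_left this
  simp only [mul_inv_rev, cs.inv_simple] at h'
  rw [← h']
  simp [mul_assoc]

/-- If a generator lengthens an element, then the element is increasing at the corresponding
positions. Together with its converse this makes the action faithful. -/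
theorem toPerm_lt_of_length_lt (w : W) (i : AffineIndex n)
    (h : cs.length w < cs.length (w * cs.simple i)) (x : ℤ)
    (hx : (x : ZMod n) = ((i.1 : ℕ) : ZMod n)) :
    toPerm cs w (x - 1) < toPerm cs w x := by
  induction hl : cs.length w using Nat.strong_induction_on generalizing w i x with
  | _ l ih =>
  subst hl
  by_cases hw : w = 1
  · subst hw; simp
  obtain ⟨j, hj⟩ := cs.exists_rightDescent_of_ne_one hw
  have hn := i.2
  have h1 := zmod_one_ne_zero hn
  have hij : i ≠ j := by
    rintro rfl
    exact absurd hj (by unfold CoxeterSystem.IsRightDescent; omega)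
  have hij' : ((i.1 : ℕ) : ZMod n) ≠ ((j.1 : ℕ) : ZMod n) := fun h' => hij (affineIndex_ext h')
  obtain ⟨v, rfl⟩ : ∃ v, w = v * cs.simple j := ⟨w * cs.simple j, by simp⟩
  rw [CoxeterSystem.IsRightDescent, cs.simple_mul_simple_cancel_right] at hj
  have hj' : cs.length (v * cs.simple j) = cs.length v + 1 := by
    rcases cs.length_mul_simple v j with h | h <;> omega
  have hvj := fun y hy => ih _ hj v j hj y hy rfl
  rw [toPerm_mul_simple_apply, toPerm_mul_simple_apply]
  have hM := affineMatrix_apply i j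
  rw [if_neg hij] at hM
  split_ifs at hM with h2 h3
  · -- The infinite dihedral case: periodicity makes the gap grow.
    subst h2
    have h20 : (2 : ZMod 2) = 0 := rfl
    have hji : ((j.1 : ℕ) : ZMod 2) = ((i.1 : ℕ) : ZMod 2) + 1 := by
      have : ∀ a b : ZMod 2, a ≠ b → b = a + 1 := by decide
      exact this _ _ hij'
    rw [swapFun_of_eq (by push_cast; rw [hx, hji]; linear_combination -h20),
      swapFun_of_add_one_eq hn (by rw [hx, hji])]
    have e1 := hvj (x - 1) (by push_cast; rw [hx, hji]; linear_combination -h20)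
    have e2 := hvj (x + 1) (by push_cast; rw [hx, hji])
    have e3 := isPeriodic_toPerm cs v (x - 1)
    have e4 := isPeriodic_toPerm cs v (x - 1 - 1)
    push_cast at e3 e4
    rw [show x - 1 + 2 = x + 1 by ring] at e3
    rw [show x - 1 - 1 + 2 = x by ring] at e4
    linarith
  · -- Neighbouring generators.
    have hn3 : 3 ≤ n := by omega
    have h2' := zmod_two_ne_zero hn3
    have hbr := simple_braid cs hM
    have hlen : cs.length (v * cs.simple i) < cs.length v →
        cs.length (v * cs.simple i) < cs.length (v * cs.simple i * cs.simple j) := by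
      intro hlt
      by_contra hcon
      obtain ⟨v', rfl⟩ : ∃ v', v = v' * cs.simple j * cs.simple i :=
        ⟨v * cs.simple i * cs.simple j, by simp⟩
      simp only [cs.simple_mul_simple_cancel_right] at hlt hcon
      have e : v' * cs.simple j * cs.simple i * cs.simple j * cs.simple i =
          v' * cs.simple i * cs.simple j := by
        rw [mul_assoc v', mul_assoc v', ← hbr]
        simp only [mul_assoc, cs.simple_mul_simple_self, mul_one]
      rw [e] at h
      rcases cs.length_mul_simple v' i with a | a <;>
      rcases cs.length_mul_simple (v' * cs.simple i) j with b | b <;>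
      rcases cs.length_mul_simple v' j with c | c <;> omega
    rcases h3 with h3 | h3
    · rw [swapFun_of_ne (x := x - 1), swapFun_of_add_one_eq hn (by rw [hx, h3])]
      rotate_left
      · push_cast; rw [hx, ← h3]
        intro h
        apply h2'
        linear_combination -h
      · push_cast; rw [hx, sub_add_cancel]
        exact hij'
      have e1 := hvj (x + 1) (by push_cast; rw [hx, h3])
      rw [add_sub_cancel_right] at e1
      rcases cs.length_mul_simple v i with h4 | h4
      · exact (ih _ hj v i (by omega) x hx rfl).trans e1
      · have h4' : cs.length (v * cs.simple i) < cs.length v := by omega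
        obtain ⟨v', hv'⟩ : ∃ v', v = v' * cs.simple i := ⟨v * cs.simple i, by simp⟩
        have h5 := hlen h4'
        rw [hv', cs.simple_mul_simple_cancel_right] at h5
        rw [hv', cs.simple_mul_simple_cancel_right, ← hv'] at h4
        rw [hv', toPerm_mul_simple_apply, toPerm_mul_simple_apply,
          swapFun_of_add_one_eq hn (x := x - 1) (by push_cast; rw [hx]; ring),
          swapFun_of_ne]
        · have := ih _ (by omega) v' j h5 (x + 1) (by push_cast; rw [hx, h3]) rfl
          simpa using this
        · push_cast; rw [hx]; simpa using h1
        · push_cast; rw [hx]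
          intro h
          apply h2'
          linear_combination h
    · rw [swapFun_of_eq (x := x - 1) (by push_cast; rw [hx, ← h3]; ring),
        swapFun_of_ne (x := x)]
      rotate_left
      · rw [hx]; exact hij'
      · rw [hx, ← h3]
        intro h
        apply h2'
        linear_combination h
      have e1 := hvj (x - 1) (by push_cast; rw [hx, ← h3]; ring)
      rcases cs.length_mul_simple v i with h4 | h4
      · exact e1.trans (ih _ hj v i (by omega) x hx rfl)
      · have h4' : cs.length (v * cs.simple i) < cs.length v := by omega
        obtain ⟨v', hv'⟩ : ∃ v', v = v' * cs.simple i := ⟨v * cs.simple i, by simp⟩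
        have h5 := hlen h4'
        rw [hv', cs.simple_mul_simple_cancel_right] at h5
        rw [hv', cs.simple_mul_simple_cancel_right, ← hv'] at h4
        rw [hv', toPerm_mul_simple_apply, toPerm_mul_simple_apply,
          swapFun_of_eq (x := x) hx, swapFun_of_ne]
        · exact ih _ (by omega) v' j h5 (x - 1) (by push_cast; rw [hx, ← h3]; ring) rfl
        · push_cast; rw [hx, ← h3]
          intro h
          apply h2'
          linear_combination -h
        · push_cast; rw [hx, ← h3]
          intro h
          apply h1
          linear_combination -h
  · -- Commuting generators.
    push Not at h3
    have hc := simple_commute cs hM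
    rw [swapFun_of_ne (x := x - 1), swapFun_of_ne (x := x)]
    · refine ih _ hj v i ?_ x hx rfl
      by_contra hcon
      rw [mul_assoc, ← hc, ← mul_assoc] at h
      rcases cs.length_mul_simple v i with a | a <;>
      rcases cs.length_mul_simple (v * cs.simple i) j with b | b <;> omega
    · rw [hx]; exact hij'
    · rw [hx]; exact h3.1
    · push_cast; rw [hx]
      intro h
      apply h3.2
      linear_combination -h
    · push_cast; rw [hx, sub_add_cancel]
      exact hij'

theorem length_lt_iff (w : W) (i : AffineIndex n) (x : ℤ)
    (hx : (x : ZMod n) = ((i.1 : ℕ) : ZMod n)) :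
    cs.length w < cs.length (w * cs.simple i) ↔ toPerm cs w (x - 1) < toPerm cs w x := by
  refine ⟨fun h => toPerm_lt_of_length_lt cs w i h x hx, fun h => ?_⟩
  by_contra hcon
  have h2 := toPerm_lt_of_length_lt cs (w * cs.simple i) i (by
    rw [cs.simple_mul_simple_cancel_right]
    rcases cs.length_mul_simple w i with h | h <;> omega) x hx
  rw [toPerm_mul_simple_apply, toPerm_mul_simple_apply, swapFun_of_eq hx,
    swapFun_of_add_one_eq i.2 (by push_cast; rw [hx]; ring)] at h2
  simp only [sub_add_cancel] at h2
  omega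

theorem toPerm_injective : Function.Injective (toPerm cs) := by
  rw [injective_iff_map_eq_one]
  intro w hw
  by_contra hne
  obtain ⟨i, hi⟩ := cs.exists_rightDescent_of_ne_one hne
  have := (length_lt_iff cs w i ((i.1 : ℕ) : ℤ) (by simp)).2 (by rw [hw]; simp)
  unfold CoxeterSystem.IsRightDescent at hi
  omega

end Hom

/-! ### Shi's length formula and the image of the action -/

section Shi

variable {n : ℕ} [NeZero n]

/-- The contribution of the pair `(x, y)` to Shi's length formula. -/
def shiTerm (n : ℕ) (u : Perm ℤ) (x y : ℤ) : ℤ := |(u y - u x) / n - (y - x) / n|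

/-- Twice the number of affine inversions of a periodic permutation `u`, by Shi's formula: each
unordered pair of residue classes is counted twice. -/
def shiSum (n : ℕ) [NeZero n] (u : Perm ℤ) : ℤ :=
  ∑ a : ZMod n, ∑ b : ZMod n, shiTerm n u (a.val : ℤ) (b.val : ℤ)

theorem cast_val_int (a : ZMod n) : (((a.val : ℕ) : ℤ) : ZMod n) = a := by simp

theorem natCast_int_ne_zero : (n : ℤ) ≠ 0 := by exact_mod_cast NeZero.ne n

theorem natCast_int_pos : (0 : ℤ) < n := by exact_mod_cast NeZero.pos n

theorem shiTerm_congr {u : Perm ℤ} (hu : IsPeriodic n u) {x y x' y' : ℤ}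
    (hx : (x : ZMod n) = x') (hy : (y : ZMod n) = y') :
    shiTerm n u x y = shiTerm n u x' y' := by
  obtain ⟨k, rfl⟩ := exists_eq_add_mul hx
  obtain ⟨l, rfl⟩ := exists_eq_add_mul hy
  have h := natCast_int_ne_zero (n := n)
  unfold shiTerm
  rw [hu.add_mul, hu.add_mul,
    show u y + n * l - (u x + n * k) = u y - u x + n * (l - k) by ring,
    show y + n * l - (x + n * k) = y - x + n * (l - k) by ring,
    Int.add_mul_ediv_left _ _ h, Int.add_mul_ediv_left _ _ h]
  congr 1
  ring

omit [NeZero n] in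
theorem cast_swapFun (hn : 2 ≤ n) (i : ZMod n) (x : ℤ) :
    ((swapFun i x : ℤ) : ZMod n) = Equiv.swap (i - 1) i (x : ZMod n) := by
  by_cases h : (x : ZMod n) = i
  · rw [swapFun_of_eq h]
    push_cast
    rw [h, Equiv.swap_apply_right]
  · by_cases h' : (x : ZMod n) + 1 = i
    · rw [swapFun_of_add_one_eq hn h']
      push_cast
      rw [← h', add_sub_cancel_right, Equiv.swap_apply_left]
    · rw [swapFun_of_ne h h', Equiv.swap_apply_of_ne_of_ne _ h]
      rintro h''
      exact h' (by rw [h'']; ring)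

theorem sub_one_ediv {d : ℤ} (h : ¬ (n : ℤ) ∣ d) : (d - 1) / n = d / n := by
  have hn := natCast_int_pos (n := n)
  rw [Int.ediv_eq_iff_of_pos hn]
  have h1 := Int.emod_add_mul_ediv d n
  have h2 := Int.emod_lt_of_pos d hn
  have h3 := Int.emod_nonneg d hn.ne'
  have h4 : d % n ≠ 0 := fun h0 => h (Int.dvd_of_emod_eq_zero h0)
  have h5 : 0 < d % n := lt_of_le_of_ne h3 h4.symm
  constructor <;> nlinarith

omit [NeZero n] in
theorem not_dvd_sub {x y : ℤ} (h : (x : ZMod n) ≠ y) : ¬ (n : ℤ) ∣ y - x := fun h' =>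
  h ((ZMod.intCast_eq_intCast_iff_dvd_sub x y n).2 h')

/-- A swap of neighbours only affects the pair of residue classes which it exchanges. -/
theorem swapFun_sub_ediv (hn : 2 ≤ n) (i : ZMod n) {x y : ℤ} (hxy : (x : ZMod n) ≠ y)
    (h : ¬ ((x : ZMod n) = i - 1 ∧ (y : ZMod n) = i))
    (h' : ¬ ((x : ZMod n) = i ∧ (y : ZMod n) = i - 1)) :
    (swapFun i y - swapFun i x) / (n : ℤ) = (y - x) / n := by
  have hd := not_dvd_sub hxy
  have hp : ¬ (n : ℤ) ∣ y + 1 - x → (y + 1 - x) / (n : ℤ) = (y - x) / n := fun hd => by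
    rw [← sub_one_ediv hd]
    congr 1
    ring
  have e1 : ∀ z : ℤ, (z : ZMod n) = i → swapFun i z = z - 1 := fun z => swapFun_of_eq
  have e2 : ∀ z : ℤ, (z : ZMod n) = i - 1 → swapFun i z = z + 1 := fun z hz =>
    swapFun_of_add_one_eq hn (by rw [hz]; ring)
  have e3 : ∀ z : ℤ, (z : ZMod n) ≠ i → (z : ZMod n) ≠ i - 1 → swapFun i z = z := fun z hz hz' =>
    swapFun_of_ne hz fun h => hz' (by rw [← h]; ring)
  by_cases hy : (y : ZMod n) = i
  · have hx : (x : ZMod n) ≠ i := fun hx => hxy (hx.trans hy.symm)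
    have hx' : (x : ZMod n) ≠ i - 1 := fun hx => h ⟨hx, hy⟩
    rw [e1 y hy, e3 x hx hx', ← sub_one_ediv hd]
    congr 1
    ring
  · by_cases hy' : (y : ZMod n) = i - 1
    · have hx : (x : ZMod n) ≠ i - 1 := fun hx => hxy (hx.trans hy'.symm)
      have hx' : (x : ZMod n) ≠ i := fun hx => h' ⟨hx, hy'⟩
      rw [e2 y hy', e3 x hx' hx]
      apply hp
      apply not_dvd_sub
      push_cast
      rw [hy']
      simpa using hx'
    · rw [e3 y hy hy']
      by_cases hx : (x : ZMod n) = i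
      · rw [e1 x hx, show y - (x - 1) = y + 1 - x by ring]
        apply hp
        apply not_dvd_sub
        push_cast
        rw [hx]
        intro hh
        exact hy' (by rw [hh]; ring)
      · by_cases hx' : (x : ZMod n) = i - 1
        · rw [e2 x hx', ← sub_one_ediv hd]
          congr 1
          ring
        · rw [e3 x hx hx']

theorem neg_one_ediv (hn : 2 ≤ n) : (-1 : ℤ) / n = -1 := by
  have hn' := natCast_int_pos (n := n)
  rw [Int.ediv_eq_iff_of_pos hn']
  constructor <;> nlinarith

omit [NeZero n] in
theorem one_ediv (hn : 2 ≤ n) : (1 : ℤ) / n = 0 :=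
  Int.ediv_eq_zero_of_lt (by norm_num) (by exact_mod_cast hn)

/-- Multiplication by a generator at an ascent permutes the terms of Shi's formula and raises those
of the exchanged pair of residue classes by one. -/
theorem shiTerm_mul_affineSwap (hn : 2 ≤ n) (i : ZMod n) {u : Perm ℤ} (hu : IsPeriodic n u)
    (hlt : ∀ x : ℤ, (x : ZMod n) = i → u (x - 1) < u x) (x y : ℤ) :
    shiTerm n (u * affineSwap hn i) x y = shiTerm n u (swapFun i x) (swapFun i y) +
      ((if (x : ZMod n) = i - 1 ∧ (y : ZMod n) = i then 1 else 0) +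
       (if (x : ZMod n) = i ∧ (y : ZMod n) = i - 1 then 1 else 0)) := by
  have hn' := natCast_int_pos (n := n)
  have h1 := zmod_one_ne_zero hn
  have hne : i ≠ i - 1 := fun h => h1 (by linear_combination h)
  have hus := hu.mul (isPeriodic_affineSwap hn i)
  by_cases hA : (x : ZMod n) = i - 1 ∧ (y : ZMod n) = i
  · rw [if_pos hA, if_neg (by rw [hA.1, hA.2]; exact fun h => hne h.2)]
    have hy : ((x + 1 : ℤ) : ZMod n) = i := by push_cast; rw [hA.1]; ring
    have hx : (x : ZMod n) + 1 = i := by rw [hA.1]; ring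
    have e := hlt _ hy
    rw [add_sub_cancel_right] at e
    rw [shiTerm_congr hus (x := x) (y := y) (x' := x) (y' := x + 1) rfl (by rw [hy, hA.2]),
      shiTerm_congr hu (x := swapFun i x) (y := swapFun i y) (x' := x + 1) (y' := x)
        (by rw [swapFun_of_add_one_eq hn hx])
        (by rw [swapFun_of_eq hA.2]; push_cast; rw [hA.1, hA.2])]
    unfold shiTerm
    rw [Perm.mul_apply, Perm.mul_apply, affineSwap_apply, affineSwap_apply,
      swapFun_of_add_one_eq hn hx, swapFun_of_eq hy, add_sub_cancel_right, add_sub_cancel_left,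
      show x - (x + 1) = -1 by ring, neg_one_ediv hn, one_ediv hn]
    have : (u x - u (x + 1)) / (n : ℤ) < 0 := Int.ediv_neg_of_neg_of_pos (by linarith) hn'
    rw [abs_of_nonpos (by linarith), abs_of_nonpos (by linarith)]
    ring
  by_cases hB : (x : ZMod n) = i ∧ (y : ZMod n) = i - 1
  · rw [if_neg hA, if_pos hB]
    have hy : (y : ZMod n) + 1 = i := by rw [hB.2]; ring
    have hx : ((y + 1 : ℤ) : ZMod n) = i := by push_cast; rw [hy]
    have e := hlt _ hx
    rw [add_sub_cancel_right] at e
    rw [shiTerm_congr hus (x := x) (y := y) (x' := y + 1) (y' := y) (by rw [hx, hB.1]) rfl,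
      shiTerm_congr hu (x := swapFun i x) (y := swapFun i y) (x' := y) (y' := y + 1)
        (by rw [swapFun_of_eq hB.1]; push_cast; rw [hB.1, hB.2])
        (by rw [swapFun_of_add_one_eq hn hy])]
    unfold shiTerm
    rw [Perm.mul_apply, Perm.mul_apply, affineSwap_apply, affineSwap_apply,
      swapFun_of_add_one_eq hn hy, swapFun_of_eq hx, add_sub_cancel_right, add_sub_cancel_left,
      show y - (y + 1) = -1 by ring, neg_one_ediv hn, one_ediv hn]
    have : 0 ≤ (u (y + 1) - u y) / (n : ℤ) := Int.ediv_nonneg (by linarith) hn'.le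
    rw [abs_of_nonneg (by linarith), abs_of_nonneg (by linarith)]
    ring
  · rw [if_neg hA, if_neg hB, add_zero, add_zero]
    by_cases hxy : (x : ZMod n) = y
    · rw [shiTerm_congr hus rfl hxy.symm, shiTerm_congr hu (x := swapFun i x) rfl
        (by rw [cast_swapFun hn, cast_swapFun hn, hxy] :
          ((swapFun i y : ℤ) : ZMod n) = (swapFun i x : ℤ))]
      simp [shiTerm]
    · unfold shiTerm
      rw [swapFun_sub_ediv hn i hxy hA hB]
      rfl

theorem shiSum_mul_affineSwap (hn : 2 ≤ n) (i : ZMod n) {u : Perm ℤ} (hu : IsPeriodic n u)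
    (hlt : ∀ x : ℤ, (x : ZMod n) = i → u (x - 1) < u x) :
    shiSum n (u * affineSwap hn i) = shiSum n u + 2 := by
  unfold shiSum
  simp_rw [shiTerm_mul_affineSwap hn i hu hlt, Finset.sum_add_distrib, cast_val_int]
  congr 1
  · rw [← Equiv.sum_comp (Equiv.swap (i - 1) i) fun a => ∑ b : ZMod n, shiTerm n u a.val b.val]
    refine Finset.sum_congr rfl fun a _ => ?_
    rw [← Equiv.sum_comp (Equiv.swap (i - 1) i)
      fun b => shiTerm n u (Equiv.swap (i - 1) i a).val b.val]
    refine Finset.sum_congr rfl fun b _ => shiTerm_congr hu ?_ ?_ <;>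
    rw [cast_swapFun hn, cast_val_int, cast_val_int]
  · simp [ite_and]

theorem shiSum_nonneg (u : Perm ℤ) : 0 ≤ shiSum n u :=
  Finset.sum_nonneg fun _ _ => Finset.sum_nonneg fun _ _ => abs_nonneg _

theorem shiSum_one : shiSum n 1 = 0 := by
  simp [shiSum, shiTerm]

/-- The total displacement of a periodic permutation, over one period. -/
def displacement (n : ℕ) [NeZero n] (u : Perm ℤ) : ℤ :=
  ∑ a : ZMod n, (u (a.val : ℤ) - (a.val : ℤ))

theorem displacement_mul_affineSwap (hn : 2 ≤ n) (i : ZMod n) {u : Perm ℤ}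
    (hu : IsPeriodic n u) : displacement n (u * affineSwap hn i) = displacement n u := by
  have h1 := zmod_one_ne_zero hn
  have hne : i - 1 ≠ i := fun h => h1 (by linear_combination -h)
  have hcongr : ∀ x y : ℤ, (x : ZMod n) = y → u x - x = u y - y := by
    intro x y h
    obtain ⟨k, rfl⟩ := exists_eq_add_mul h
    rw [hu.add_mul]; ring
  have key : ∀ a : ZMod n, (u * affineSwap hn i) (a.val : ℤ) - (a.val : ℤ) =
      (u ((Equiv.swap (i - 1) i a).val : ℤ) - ((Equiv.swap (i - 1) i a).val : ℤ)) +
      ((if a = i - 1 then 1 else 0) - (if a = i then 1 else 0)) := by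
    intro a
    rw [hcongr _ (swapFun i (a.val : ℤ)) (by rw [cast_swapFun hn, cast_val_int, cast_val_int]),
      Perm.mul_apply, affineSwap_apply]
    by_cases ha : a = i
    · rw [swapFun_of_eq (by rw [cast_val_int, ha]), if_neg (by rw [ha]; exact hne.symm),
        if_pos ha]
      ring
    · by_cases ha' : a = i - 1
      · rw [swapFun_of_add_one_eq hn (by rw [cast_val_int, ha']; ring), if_pos ha', if_neg ha]
        ring
      · rw [swapFun_of_ne (by rwa [cast_val_int])
          (by rw [cast_val_int]; exact fun h => ha' (by rw [← h]; ring)), if_neg ha, if_neg ha']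
        ring
  unfold displacement
  simp_rw [key]
  rw [Finset.sum_add_distrib, Equiv.sum_comp (Equiv.swap (i - 1) i)
    fun a : ZMod n => u (a.val : ℤ) - (a.val : ℤ)]
  simp

variable {W : Type*} [Group W] (cs : CoxeterSystem (affineMatrix n) W)

/-- Shi's formula for the length function of the affine group. -/
theorem two_mul_length (w : W) : (2 * cs.length w : ℤ) = shiSum n (toPerm cs w) := by
  induction w using cs.simple_induction_right with
  | one => simp [shiSum_one]
  | mul_simple_right w i ih =>
    have hu := isPeriodic_toPerm cs w
    by_cases h : cs.length w < cs.length (w * cs.simple i)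
    · rw [map_mul, toPerm_simple, shiSum_mul_affineSwap i.2 _ hu
        fun x hx => (length_lt_iff cs w i x hx).1 h, ← ih]
      rcases cs.length_mul_simple w i with h' | h' <;> omega
    · have h2 := shiSum_mul_affineSwap i.2 _ (isPeriodic_toPerm cs (w * cs.simple i))
        fun x hx => (length_lt_iff cs (w * cs.simple i) i x hx).1 (by
          rw [cs.simple_mul_simple_cancel_right]
          rcases cs.length_mul_simple w i with h' | h' <;> omega)
      rw [← toPerm_simple cs i, ← map_mul, cs.simple_mul_simple_cancel_right, ← ih] at h2
      rcases cs.length_mul_simple w i with h' | h' <;> omega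

omit [NeZero n] in
theorem toPerm_residueIndex (hn : 2 ≤ n) (z : ZMod n) :
    toPerm cs (cs.simple (residueIndex hn z)) = affineSwap hn z := by
  rw [toPerm_simple, cast_residueIndex]

/-- Every periodic permutation of total displacement zero comes from the affine group. -/
theorem exists_toPerm_eq {u : Perm ℤ} (hu : IsPeriodic n u) (hd : displacement n u = 0) :
    ∃ w : W, toPerm cs w = u := by
  induction hl : (shiSum n u).toNat using Nat.strong_induction_on generalizing u with
  | _ l ih =>
  subst hl
  by_cases hdesc : ∃ x, u x < u (x - 1)
  · obtain ⟨x, hx⟩ := hdesc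
    have hn : 2 ≤ n := by
      by_contra h
      have h1 : n = 1 := by have := NeZero.pos n; omega
      have := hu (x - 1)
      rw [h1] at this
      push_cast at this
      rw [sub_add_cancel] at this
      omega
    set i : ZMod n := (x : ZMod n) with hi
    have hus := hu.mul (isPeriodic_affineSwap hn i)
    have h2 := shiSum_mul_affineSwap hn i hus fun y hy => by
      rw [hus.lt_iff (y := x) (by rw [hy])]
      rw [Perm.mul_apply, Perm.mul_apply, affineSwap_apply, affineSwap_apply,
        swapFun_of_eq rfl, swapFun_of_add_one_eq hn (by push_cast; rw [hi]; ring),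
        sub_add_cancel]
      exact hx
    rw [mul_assoc, affineSwap_mul_self, mul_one] at h2
    have h3 := shiSum_nonneg (n := n) (u * affineSwap hn i)
    obtain ⟨w, hw⟩ := ih _ (by omega) hus
      (by rw [displacement_mul_affineSwap hn i hu, hd]) rfl
    exact ⟨w * cs.simple (residueIndex hn i), by
      rw [map_mul, hw, toPerm_residueIndex, mul_assoc, affineSwap_mul_self, mul_one]⟩
  · push Not at hdesc
    have hmono : StrictMono u := strictMono_int_of_lt_succ fun x =>
      lt_of_le_of_ne (by simpa using hdesc (x + 1)) (u.injective.ne (by omega))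
    have hstep : ∀ x, u (x + 1) = u x + 1 := by
      intro x
      obtain ⟨y, hy⟩ := u.surjective (u x + 1)
      have h1 : u x < u y := by omega
      have h2 : u y ≤ u (x + 1) := by
        have := hmono (lt_add_one x)
        omega
      have h3 := hmono.lt_iff_lt.1 h1
      have h4 := hmono.le_iff_le.1 h2
      rw [← hy]
      congr 1
      omega
    have hconst : ∀ x, u x = x + u 0 := by
      intro x
      induction x using Int.induction_on with
      | zero => simp
      | succ k ih => rw [hstep, ih]; ring
      | pred k ih =>
        have := hstep (-k - 1)
        rw [sub_add_cancel] at this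
        linarith
    have h0 : u 0 = 0 := by
      unfold displacement at hd
      have hd' : ∑ _a : ZMod n, u 0 = 0 := by
        refine Eq.trans (Finset.sum_congr rfl fun a _ => ?_) hd
        rw [hconst a.val, add_sub_cancel_left]
      rw [Finset.sum_const, Finset.card_univ, ZMod.card] at hd'
      simpa [NeZero.ne n] using hd'
    refine ⟨1, ?_⟩
    rw [map_one]
    ext x
    rw [hconst x, h0, add_zero, Perm.one_apply]

end Shi

/-! ### The absolute length function -/

section AbsoluteLength

variable {n : ℕ} [NeZero n]

/-- The residue classes which are fixed pointwise by the periodic permutation `u`. -/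
def fixedClasses (n : ℕ) [NeZero n] (u : Perm ℤ) : Finset (ZMod n) :=
  Finset.univ.filter fun a => u (a.val : ℤ) = (a.val : ℤ)

omit [NeZero n] in
theorem IsPeriodic.apply_eq_self_iff {u : Perm ℤ} (hu : IsPeriodic n u) {x y : ℤ}
    (h : (x : ZMod n) = y) : u x = x ↔ u y = y := by
  obtain ⟨k, rfl⟩ := exists_eq_add_mul h
  rw [hu.add_mul]
  simp

theorem IsPeriodic.mem_fixedClasses {u : Perm ℤ} (hu : IsPeriodic n u) (x : ℤ) :
    (x : ZMod n) ∈ fixedClasses n u ↔ u x = x := by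
  simp only [fixedClasses, Finset.mem_filter, Finset.mem_univ, true_and]
  exact hu.apply_eq_self_iff (cast_val_int _)

/-- An involution cannot exchange `x` and `y` up to a nontrivial translation. For `x = y`, this says
that it fixes every residue class pointwise which it maps to itself. -/
theorem IsPeriodic.eq_zero_of_involutive {u : Perm ℤ} (hu : IsPeriodic n u)
    (hinv : ∀ x, u (u x) = x) {x y k : ℤ} (h : u x = y + n * k) (h' : u y = x + n * k) :
    k = 0 := by
  have h1 := hinv x
  rw [h, hu.add_mul, h'] at h1
  have hn := natCast_int_ne_zero (n := n)
  have : (n : ℤ) * (2 * k) = 0 := by linarith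
  rcases mul_eq_zero.1 this with h | h
  · exact absurd h hn
  · omega

/-- An involution which commutes with the swap of `x - 1` and `x` fixes both or exchanges them. -/
theorem IsPeriodic.fixes_or_swaps_of_commute {u : Perm ℤ} (hu : IsPeriodic n u)
    (hinv : ∀ x, u (u x) = x) (hn : 2 ≤ n) {i : ZMod n}
    (hc : ∀ x, u (swapFun i x) = swapFun i (u x)) {x : ℤ} (hx : (x : ZMod n) = i) :
    (u (x - 1) = x - 1 ∧ u x = x) ∨ (u (x - 1) = x ∧ u x = x - 1) := by
  have h1 := hc x
  rw [swapFun_of_eq hx] at h1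
  have hne : u (x - 1) ≠ u x := u.injective.ne (by omega)
  by_cases h : ((u x : ℤ) : ZMod n) = i
  · obtain ⟨k, hk⟩ := exists_eq_add_mul (hx.trans h.symm)
    have := hu.eq_zero_of_involutive hinv hk hk
    rw [this, mul_zero, add_zero] at hk
    rw [swapFun_of_eq h, hk] at h1
    exact Or.inl ⟨h1, hk⟩
  · by_cases h' : ((u x : ℤ) : ZMod n) + 1 = i
    · have h2 : ((x - 1 : ℤ) : ZMod n) = u x := by
        push_cast
        rw [hx, ← h', add_sub_cancel_right]
      obtain ⟨k, hk⟩ := exists_eq_add_mul h2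
      rw [swapFun_of_add_one_eq hn h'] at h1
      have := hu.eq_zero_of_involutive hinv hk (by rw [h1, hk]; ring)
      rw [this, mul_zero, add_zero] at hk
      rw [hk] at h1
      exact Or.inr ⟨by rw [h1]; ring, hk⟩
    · rw [swapFun_of_ne h h'] at h1
      exact absurd h1 hne

theorem card_fixedClasses_mul_affineSwap {u : Perm ℤ} (hu : IsPeriodic n u) (hn : 2 ≤ n)
    {i : ZMod n} {x : ℤ} (hx : (x : ZMod n) = i) (h : u (x - 1) = x - 1) (h' : u x = x) :
    (fixedClasses n u).card = (fixedClasses n (u * affineSwap hn i)).card + 2 := by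
  have h1 := zmod_one_ne_zero hn
  have hne : i - 1 ≠ i := fun h => h1 (by linear_combination -h)
  have hus := hu.mul (isPeriodic_affineSwap hn i)
  have key : fixedClasses n u =
      insert (i - 1) (insert i (fixedClasses n (u * affineSwap hn i))) := by
    ext a
    rw [← cast_val_int a, Finset.mem_insert, Finset.mem_insert, hu.mem_fixedClasses,
      hus.mem_fixedClasses, Perm.mul_apply, affineSwap_apply]
    by_cases ha : ((a.val : ℤ) : ZMod n) = i
    · simp only [ha, true_or, or_true, iff_true]
      exact (hu.apply_eq_self_iff (hx.trans ha.symm)).1 h'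
    · by_cases ha' : ((a.val : ℤ) : ZMod n) = i - 1
      · simp only [ha', true_or, iff_true]
        refine (hu.apply_eq_self_iff (x := x - 1) ?_).1 h
        push_cast
        rw [hx, ← ha']
        push_cast
        rfl
      · simp only [ha, ha', false_or]
        rw [swapFun_of_ne ha fun h => ha' (by rw [← h]; ring)]
  rw [key, Finset.card_insert_of_notMem, Finset.card_insert_of_notMem]
  · rw [show i = ((x : ℤ) : ZMod n) from hx.symm] at hus ⊢
    rw [hus.mem_fixedClasses, Perm.mul_apply, affineSwap_apply, swapFun_of_eq rfl, h]
    omega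
  · rw [Finset.mem_insert, not_or]
    refine ⟨hne, ?_⟩
    rw [show i - 1 = ((x - 1 : ℤ) : ZMod n) by push_cast; rw [hx], hus.mem_fixedClasses,
      Perm.mul_apply, affineSwap_apply,
      swapFun_of_add_one_eq hn (by push_cast; rw [hx]; ring), sub_add_cancel, h']
    omega

variable {W : Type*} [Group W] (cs : CoxeterSystem (affineMatrix n) W)

omit [NeZero n] in
theorem toPerm_involutive {w : W} (hw : w⁻¹ = w) (x : ℤ) :
    toPerm cs w (toPerm cs w x) = x := by
  rw [← Perm.mul_apply, ← map_mul]
  nth_rewrite 1 [← hw]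
  simp

/-- The number of two-element orbits of residue classes under an involution. -/
noncomputable def absoluteLength (w : involutions W) : ℕ :=
  (n - (fixedClasses n (toPerm cs (w : W))).card) / 2

theorem card_fixedClasses_le (u : Perm ℤ) : (fixedClasses n u).card ≤ n := by
  simpa [ZMod.card] using Finset.card_le_univ (fixedClasses n u)

theorem isAbsoluteLength_absoluteLength :
    IsAbsoluteLength cs (absoluteLength cs) where
  one w hw := by
    simp [absoluteLength, hw, fixedClasses, ZMod.card]
  conj i w v hv := by
    have hw := isPeriodic_toPerm cs (w : W)
    have hv' := isPeriodic_toPerm cs (v : W)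
    unfold absoluteLength
    congr 2
    refine Finset.card_equiv (Equiv.swap (((i.1 : ℕ) : ZMod n) - 1) ((i.1 : ℕ) : ZMod n))
      fun a => ?_
    rw [← cast_val_int a, ← cast_swapFun i.2, hw.mem_fixedClasses, hv'.mem_fixedClasses, hv,
      toPerm_mul_simple_apply, map_mul, Perm.mul_apply, toPerm_simple, affineSwap_apply]
    exact (swapFun_involutive i.2 _).eq_iff
  mul i w v hv := by
    have hw : (w : W)⁻¹ = w := w.2
    have hv2 : (v : W)⁻¹ = v := v.2
    have hvs : (w : W) = v * cs.simple i := by rw [hv, cs.simple_mul_simple_cancel_right]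
    have hcomm : (w : W) * cs.simple i = cs.simple i * w := by
      rw [← hv, ← hv2, hv, mul_inv_rev, cs.inv_simple, hw]
    have hx : (((i.1 : ℕ) : ℤ) : ZMod n) = ((i.1 : ℕ) : ZMod n) := by simp
    set x : ℤ := ((i.1 : ℕ) : ℤ)
    have hpw := isPeriodic_toPerm cs (w : W)
    have hpv := isPeriodic_toPerm cs (v : W)
    have hlt := length_lt_iff cs (w : W) i x hx
    have hl := cs.length_mul_simple (w : W) i
    rw [← hv] at hlt hl
    have hle := card_fixedClasses_le (n := n) (toPerm cs (w : W))
    have hle' := card_fixedClasses_le (n := n) (toPerm cs (v : W))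
    unfold absoluteLength
    rcases hpw.fixes_or_swaps_of_commute (toPerm_involutive cs hw) i.2 (i := (i.1 : ℕ)) (fun y => by
      rw [← toPerm_mul_simple_apply, hcomm, map_mul, toPerm_simple]; rfl) hx
      with ⟨h1, h2⟩ | ⟨h1, h2⟩
    · have h3 := card_fixedClasses_mul_affineSwap hpw i.2 hx h1 h2
      rw [← toPerm_simple cs i, ← map_mul, ← hv] at h3
      rw [h1, h2] at hlt
      have := hlt.2 (by omega)
      omega
    · have h3 := card_fixedClasses_mul_affineSwap hpv i.2 hx
        (by rw [hv, toPerm_mul_simple_apply,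
              swapFun_of_add_one_eq i.2 (by push_cast; rw [hx]; ring), sub_add_cancel, h2])
        (by rw [hv, toPerm_mul_simple_apply, swapFun_of_eq hx, h1])
      rw [← toPerm_simple cs i, ← map_mul, ← hvs] at h3
      rw [h1, h2] at hlt
      have : ¬ cs.length (w : W) < cs.length (v : W) := by
        rw [hlt]; omega
      omega

omit [NeZero n] in
theorem eq_add_one_of_swapFun_lt {i : ZMod n} {a b : ℤ} (h : b < a)
    (h' : swapFun i a < swapFun i b) : a = b + 1 ∧ (a : ZMod n) = i := by
  have h1 : ∀ z : ℤ, z - 1 ≤ swapFun i z ∧ swapFun i z ≤ z + 1 := by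
    intro z
    unfold swapFun
    split_ifs <;> omega
  have h2 := h1 a
  have h3 := h1 b
  refine ⟨by omega, ?_⟩
  by_contra hne
  have : a ≤ swapFun i a := by
    unfold swapFun
    rw [if_neg hne]
    split_ifs <;> omega
  omega

/-- An involution with a descent `s` is shortened under conjugation by `s`, unless it commutes
with `s`. -/
theorem length_conj_lt {w : W} (hw : w⁻¹ = w) (i : AffineIndex n)
    (hd : cs.length (w * cs.simple i) < cs.length w)
    (hne : cs.simple i * w * cs.simple i ≠ w) :
    cs.length (cs.simple i * w * cs.simple i) < cs.length w := by
  have hx : (((i.1 : ℕ) : ℤ) : ZMod n) = ((i.1 : ℕ) : ZMod n) := by simp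
  set x : ℤ := ((i.1 : ℕ) : ℤ)
  have hp := isPeriodic_toPerm cs w
  have hinv := toPerm_involutive cs hw
  have hlen : cs.length (cs.simple i * w) = cs.length (w * cs.simple i) := by
    rw [← cs.length_inv, mul_inv_rev, cs.inv_simple, hw]
  by_contra hcon
  have hlt : cs.length (cs.simple i * w) < cs.length (cs.simple i * w * cs.simple i) := by omega
  rw [length_lt_iff cs _ i x hx, map_mul, toPerm_simple, Perm.mul_apply, Perm.mul_apply,
    affineSwap_apply, affineSwap_apply] at hlt
  have hdesc : toPerm cs w x < toPerm cs w (x - 1) := by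
    have := (length_lt_iff cs w i x hx).not.1 (by omega)
    exact lt_of_le_of_ne (not_lt.1 this) ((toPerm cs w).injective.ne (by omega))
  obtain ⟨h1, h2⟩ := eq_add_one_of_swapFun_lt hdesc hlt
  obtain ⟨k, hk⟩ := exists_eq_add_mul (hx.trans h2.symm)
  have hk' : toPerm cs w x = x - 1 + n * k := by linarith
  have hk0 := hp.eq_zero_of_involutive hinv hk hk'
  rw [hk0, mul_zero, add_zero] at hk hk'
  apply hne
  apply toPerm_injective cs
  ext z
  rw [toPerm_mul_simple_apply, map_mul, Perm.mul_apply, toPerm_simple, affineSwap_apply]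
  by_cases hz : (z : ZMod n) = ((i.1 : ℕ) : ZMod n)
  · obtain ⟨l, rfl⟩ := exists_eq_add_mul (hx.trans hz.symm)
    rw [swapFun_of_eq hz, show x + n * l - 1 = x - 1 + n * l by ring, hp.add_mul, hp.add_mul, hk,
      hk', swapFun_of_eq hz]
    ring
  · by_cases hz' : (z : ZMod n) + 1 = ((i.1 : ℕ) : ZMod n)
    · obtain ⟨l, hl⟩ := exists_eq_add_mul (n := n) (x := x) (y := z + 1)
        (by push_cast; rw [hx, hz'])
      have hl' : z = x - 1 + n * l := by linarith
      rw [swapFun_of_add_one_eq i.2 hz', hl, hl', hp.add_mul, hp.add_mul, hk, hk',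
        swapFun_of_add_one_eq i.2 (by push_cast; rw [hx]; simp)]
      ring
    · rw [swapFun_of_ne hz hz', swapFun_of_ne]
      · intro h
        apply hz'
        have := hp.cast_injective (x := z) (y := x - 1) (by rw [h, hk, hx])
        rw [this]
        push_cast
        rw [hx]
        ring
      · intro h
        apply hz
        have := hp.cast_injective (x := z) (y := x) (by
          rw [hk']; push_cast; rw [hx, ← h]; ring)
        rw [this, hx]

/-- The absolute length is determined by induction on the length: a descent of an involution either
commutes with it or shortens it under conjugation. -/
theorem IsAbsoluteLength.unique {e f : involutions W → ℕ} (he : IsAbsoluteLength cs e)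
    (hf : IsAbsoluteLength cs f) : e = f := by
  funext w
  induction hl : cs.length (w : W) using Nat.strong_induction_on generalizing w with
  | _ l ih =>
  subst hl
  by_cases hw1 : (w : W) = 1
  · rw [he.one w hw1, hf.one w hw1]
  obtain ⟨i, hi⟩ := cs.exists_rightDescent_of_ne_one hw1
  unfold CoxeterSystem.IsRightDescent at hi
  have hw : (w : W)⁻¹ = w := w.2
  by_cases hc : cs.simple i * w * cs.simple i = w
  · have hv : ((w : W) * cs.simple i)⁻¹ = w * cs.simple i := by
      rw [mul_inv_rev, cs.inv_simple, hw]
      nth_rewrite 2 [← hc]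
      rw [cs.simple_mul_simple_cancel_right]
    have h1 := he.mul i w ⟨_, hv⟩ rfl
    have h2 := hf.mul i w ⟨_, hv⟩ rfl
    have h3 := ih _ hi ⟨_, hv⟩ rfl
    omega
  · have hv : (cs.simple i * w * cs.simple i)⁻¹ = cs.simple i * w * cs.simple i := by
      rw [mul_inv_rev, mul_inv_rev, cs.inv_simple, hw, mul_assoc]
    have h1 := he.conj i w ⟨_, hv⟩ rfl
    have h2 := hf.conj i w ⟨_, hv⟩ rfl
    have h3 := ih _ (length_conj_lt cs hw i hi hc) ⟨_, hv⟩ rfl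
    rw [← h1, ← h2, h3]

end AbsoluteLength

/-! ### Involutions which are increasing on a window -/

section Window

variable {n : ℕ} [NeZero n]

/-- The residue of an integer in the window `{0, …, n - 1}`. -/
def residue (n : ℕ) [NeZero n] (z : ℤ) : Fin n :=
  ⟨(z % n).toNat, by
    have h1 := Int.emod_nonneg z (natCast_int_ne_zero (n := n))
    have h2 := Int.emod_lt_of_pos z (natCast_int_pos (n := n))
    omega⟩

theorem coe_residue (z : ℤ) : ((residue n z : ℕ) : ℤ) = z % n :=
  Int.toNat_of_nonneg (Int.emod_nonneg z natCast_int_ne_zero)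

theorem coe_residue_add (z : ℤ) : ((residue n z : ℕ) : ℤ) + n * (z / n) = z := by
  rw [coe_residue, Int.emod_add_mul_ediv]

theorem residue_add_mul (i : Fin n) (k : ℤ) : residue n ((i : ℕ) + n * k : ℤ) = i := by
  apply Fin.ext
  have h : ((residue n ((i : ℕ) + n * k : ℤ) : ℕ) : ℤ) = (i : ℕ) := by
    rw [coe_residue, Int.add_mul_emod_self_left]
    exact Int.emod_eq_of_lt (by positivity) (by exact_mod_cast i.2)
  exact_mod_cast h

theorem add_mul_ediv_of_fin (i : Fin n) (k : ℤ) : ((i : ℕ) + n * k : ℤ) / n = k := by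
  rw [Int.add_mul_ediv_left _ _ natCast_int_ne_zero,
    Int.ediv_eq_zero_of_lt (by positivity) (by exact_mod_cast i.2), zero_add]

theorem sum_zmod_val {A : Type*} [AddCommMonoid A] (f : ℕ → A) :
    ∑ a : ZMod n, f a.val = ∑ i : Fin n, f i := by
  obtain ⟨m, rfl⟩ : ∃ m, n = m + 1 := ⟨n - 1, by have := NeZero.pos n; omega⟩
  rfl

theorem card_fixedClasses_eq (u : Perm ℤ) :
    (fixedClasses n u).card =
      (Finset.univ.filter fun i : Fin n => u ((i : ℕ) : ℤ) = ((i : ℕ) : ℤ)).card := by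
  rw [fixedClasses, Finset.card_filter, Finset.card_filter]
  exact sum_zmod_val fun m => if u (m : ℤ) = (m : ℤ) then 1 else 0

theorem shiSum_eq (u : Perm ℤ) :
    shiSum n u = ∑ i : Fin n, ∑ j : Fin n, shiTerm n u ((i : ℕ) : ℤ) ((j : ℕ) : ℤ) := by
  unfold shiSum
  rw [sum_zmod_val fun m => ∑ b : ZMod n, shiTerm n u (m : ℤ) (b.val : ℤ)]
  exact Finset.sum_congr rfl fun i _ =>
    sum_zmod_val fun m => shiTerm n u ((i : ℕ) : ℤ) (m : ℤ)

theorem displacement_eq (u : Perm ℤ) :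
    displacement n u = ∑ i : Fin n, (u ((i : ℕ) : ℤ) - ((i : ℕ) : ℤ)) :=
  sum_zmod_val fun m => u (m : ℤ) - (m : ℤ)

/-- The index of the translate of the window in which the image of `i` lies. -/
def level (u : Perm ℤ) (i : Fin n) : ℤ := u ((i : ℕ) : ℤ) / n

/-- The residue of the image of `i`. -/
def partner (u : Perm ℤ) (i : Fin n) : Fin n := residue n (u ((i : ℕ) : ℤ))

theorem partner_add_level (u : Perm ℤ) (i : Fin n) :
    u ((i : ℕ) : ℤ) = (partner u i : ℕ) + n * level u i :=
  (coe_residue_add _).symm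

theorem apply_partner {u : Perm ℤ} (hu : IsPeriodic n u) (hinv : ∀ x, u (u x) = x) (i : Fin n) :
    u ((partner u i : ℕ) : ℤ) = (i : ℕ) + n * -level u i := by
  have h := hinv (i : ℕ)
  rw [partner_add_level u i, hu.add_mul] at h
  linarith

theorem level_partner {u : Perm ℤ} (hu : IsPeriodic n u) (hinv : ∀ x, u (u x) = x) (i : Fin n) :
    level u (partner u i) = -level u i := by
  rw [level, apply_partner hu hinv, add_mul_ediv_of_fin]

theorem partner_partner {u : Perm ℤ} (hu : IsPeriodic n u) (hinv : ∀ x, u (u x) = x)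
    (i : Fin n) : partner u (partner u i) = i := by
  rw [partner, apply_partner hu hinv, residue_add_mul]

theorem partner_involutive {u : Perm ℤ} (hu : IsPeriodic n u) (hinv : ∀ x, u (u x) = x) :
    Function.Involutive (partner (n := n) u) := fun i => partner_partner hu hinv i

theorem displacement_of_involutive {u : Perm ℤ} (hu : IsPeriodic n u)
    (hinv : ∀ x, u (u x) = x) : displacement n u = 0 := by
  have h : displacement n u = -displacement n u := by
    rw [displacement_eq]
    nth_rewrite 1 [← Equiv.sum_comp ((partner_involutive hu hinv).toPerm)]
    rw [← Finset.sum_neg_distrib]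
    refine Finset.sum_congr rfl fun i _ => ?_
    rw [Function.Involutive.coe_toPerm, apply_partner hu hinv, partner_add_level u i]
    ring
  omega

theorem sum_Ioo_neg (f : ℤ → ℤ) (N : ℕ) :
    ∑ t ∈ Finset.Ioo (-((N + 1 : ℕ) : ℤ)) ((N + 1 : ℕ) : ℤ), f t =
      f 0 + ∑ j ∈ Finset.range N, (f ((j : ℤ) + 1) + f (-((j : ℤ) + 1))) := by
  induction N with
  | zero =>
    rw [show Finset.Ioo (-((0 + 1 : ℕ) : ℤ)) ((0 + 1 : ℕ) : ℤ) = {0} by rfl]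
    simp
  | succ N ih =>
    have h : Finset.Ioo (-((N + 1 + 1 : ℕ) : ℤ)) ((N + 1 + 1 : ℕ) : ℤ) =
        insert ((N : ℤ) + 1) (insert (-((N : ℤ) + 1))
          (Finset.Ioo (-((N + 1 : ℕ) : ℤ)) ((N + 1 : ℕ) : ℤ))) := by
      ext t
      simp only [Finset.mem_Ioo, Finset.mem_insert]
      omega
    rw [h, Finset.sum_insert, Finset.sum_insert, ih, Finset.sum_range_succ]
    · ring
    · simp
    · simp only [Finset.mem_insert, Finset.mem_Ioo]
      omega

/-- A periodic involution of `ℤ` which is increasing on the window `{0, …, n - 1}`. These are the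
involutions of minimal length in their double coset. -/
structure IsMinInvolution (n : ℕ) (u : Perm ℤ) : Prop where
  periodic : IsPeriodic n u
  involutive : ∀ x, u (u x) = x
  mono : ∀ i j : Fin n, i < j → u ((i : ℕ) : ℤ) < u ((j : ℕ) : ℤ)

namespace IsMinInvolution

variable {u : Perm ℤ} (hu : IsMinInvolution n u)

include hu

theorem level_mono : Monotone (level (n := n) u) := by
  intro i j h
  rcases h.lt_or_eq with h | rfl
  · exact Int.ediv_le_ediv natCast_int_pos (hu.mono i j h).le
  · exact le_rfl

theorem partner_lt {i j : Fin n} (h : level u i < level u j) : partner u j < partner u i := by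
  by_contra hcon
  have := hu.level_mono (not_lt.1 hcon)
  rw [level_partner hu.periodic hu.involutive, level_partner hu.periodic hu.involutive] at this
  omega

theorem apply_eq_self_iff (i : Fin n) : u ((i : ℕ) : ℤ) = (i : ℕ) ↔ level u i = 0 := by
  constructor
  · intro h
    rw [level, h]
    simpa using add_mul_ediv_of_fin i 0
  · intro h
    have h1 := partner_add_level u i
    have h2 := apply_partner hu.periodic hu.involutive i
    rw [h] at h1 h2
    simp only [mul_zero, add_zero, neg_zero] at h1 h2
    rcases lt_trichotomy i (partner u i) with h3 | h3 | h3
    · have := hu.mono _ _ h3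
      rw [h1, h2] at this
      have : (partner u i : ℕ) < (i : ℕ) := by exact_mod_cast this
      exact absurd h3 (by rw [Fin.lt_def]; omega)
    · rw [h1, ← h3]
    · have := hu.mono _ _ h3
      rw [h1, h2] at this
      have : (i : ℕ) < (partner u i : ℕ) := by exact_mod_cast this
      exact absurd h3 (by rw [Fin.lt_def]; omega)

/-- Within a level, the images of consecutive elements are consecutive. -/
theorem apply_add_one {i j : Fin n} (hij : (j : ℕ) = i + 1) (h : level u i = level u j) :
    u ((j : ℕ) : ℤ) = u ((i : ℕ) : ℤ) + 1 := by
  have hlt := hu.mono i j (by rw [Fin.lt_def]; omega)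
  have hi := partner_add_level u i
  have hj := partner_add_level u j
  rw [← h] at hj
  by_contra hne
  have h1 : (partner u i : ℕ) + 1 < (partner u j : ℕ) := by omega
  -- An element between the two partners would be mapped between `i` and `j`.
  let y : Fin n := ⟨(partner u i : ℕ) + 1, h1.trans (partner u j).2⟩
  have h2 := hu.mono (partner u i) y (by rw [Fin.lt_def]; exact Nat.lt_succ_self _)
  have h3 := hu.mono y (partner u j) (by rw [Fin.lt_def]; exact h1)
  rw [apply_partner hu.periodic hu.involutive, h] at h2
  rw [apply_partner hu.periodic hu.involutive] at h3
  omega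

/-- The elements of a level are reflected to those of the opposite level. -/
theorem card_level (p : ℤ → Prop) [DecidablePred p] :
    (Finset.univ.filter fun i : Fin n => p (level u i)).card =
      (Finset.univ.filter fun i : Fin n => p (-level u i)).card := by
  refine Finset.card_equiv
    (partner_involutive hu.periodic hu.involutive).toPerm fun i => ?_
  simp only [Finset.mem_filter, Finset.mem_univ, true_and, Function.Involutive.coe_toPerm]
  rw [level_partner hu.periodic hu.involutive, neg_neg]

omit hu in
/-- The number of elements of the window below the level `t`. -/
def levelCount (n : ℕ) [NeZero n] (u : Perm ℤ) (t : ℤ) : ℕ :=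
  (Finset.univ.filter fun i : Fin n => level u i < t).card

theorem levelCount_add (t : ℤ) : levelCount n u t + levelCount n u (1 - t) = n := by
  unfold levelCount
  rw [hu.card_level fun m => m < 1 - t]
  have h : (Finset.univ.filter fun i : Fin n => -level u i < 1 - t) =
      Finset.univ.filter fun i : Fin n => ¬ level u i < t := by
    ext i
    simp only [Finset.mem_filter, Finset.mem_univ, true_and]
    omega
  rw [h, Finset.card_filter_add_card_filter_not, Finset.card_univ, Fintype.card_fin]

theorem level_lt_iff (i : Fin n) (t : ℤ) : level u i < t ↔ (i : ℕ) < levelCount n u t := by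
  constructor
  · intro h
    have : Finset.Iic i ⊆ Finset.univ.filter fun i : Fin n => level u i < t := by
      intro j hj
      rw [Finset.mem_Iic] at hj
      simp only [Finset.mem_filter, Finset.mem_univ, true_and]
      exact (hu.level_mono hj).trans_lt h
    have := Finset.card_le_card this
    rw [Fin.card_Iic] at this
    exact this
  · intro h
    by_contra hcon
    have : (Finset.univ.filter fun i : Fin n => level u i < t) ⊆ Finset.Iio i := by
      intro j hj
      rw [Finset.mem_Iio]
      simp only [Finset.mem_filter, Finset.mem_univ, true_and] at hj
      by_contra hji
      have := hu.level_mono (not_lt.1 hji)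
      omega
    have := Finset.card_le_card this
    rw [Fin.card_Iio] at this
    unfold levelCount at h
    omega

omit hu in
/-- The sequence which encodes a minimal involution: the `j`-th term is the number of elements of
the window which are moved down by more than `j` windows. -/
def profile (n : ℕ) [NeZero n] (u : Perm ℤ) (j : ℕ) : ℕ := levelCount n u (-(j : ℤ))

omit hu in
theorem profile_antitone : Antitone (profile n u) := by
  intro i j h
  unfold profile levelCount
  refine Finset.card_le_card fun x hx => ?_
  simp only [Finset.mem_filter, Finset.mem_univ, true_and] at hx ⊢
  omega

theorem levelCount_natCast_add_one (j : ℕ) : levelCount n u (j + 1) = n - profile n u j := by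
  have := hu.levelCount_add (j + 1)
  rw [show (1 : ℤ) - (j + 1) = -j by ring] at this
  unfold profile
  omega

omit hu [NeZero n] in
theorem exists_level_bound (u : Perm ℤ) : ∃ N : ℕ, ∀ i : Fin n, -(N : ℤ) < level u i ∧
    level u i < N := by
  refine ⟨∑ i : Fin n, ((level u i).natAbs + 1), fun i => ?_⟩
  have := Finset.single_le_sum (f := fun i : Fin n => (level u i).natAbs + 1)
    (fun _ _ => Nat.zero_le _) (Finset.mem_univ i)
  omega

omit hu in
theorem exists_profile_eq_zero (u : Perm ℤ) : ∃ N, profile n u N = 0 := by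
  obtain ⟨N, hN⟩ := exists_level_bound (n := n) u
  refine ⟨N, ?_⟩
  rw [profile, levelCount, Finset.card_eq_zero, Finset.filter_eq_empty_iff]
  intro i _
  have := (hN i).1
  omega

theorem card_fixedClasses : (fixedClasses n u).card + 2 * profile n u 0 = n := by
  rw [card_fixedClasses_eq]
  simp_rw [hu.apply_eq_self_iff]
  have h1 : profile n u 0 = (Finset.univ.filter fun i : Fin n => level u i < 0).card := by
    simp [profile, levelCount]
  have h2 := hu.card_level fun m => m < 0
  have h3 : (Finset.univ.filter fun i : Fin n => level u i = 0).card +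
      ((Finset.univ.filter fun i : Fin n => level u i < 0).card +
      (Finset.univ.filter fun i : Fin n => -level u i < 0).card) = n := by
    rw [Finset.card_filter, Finset.card_filter, Finset.card_filter, ← Finset.sum_add_distrib,
      ← Finset.sum_add_distrib]
    rw [Finset.sum_congr rfl (g := fun _ => 1)]
    · simp
    · intro i _
      split_ifs <;> omega
  omega

/-- A minimal involution is determined by its profile. -/
theorem ext_profile {v : Perm ℤ} (hv : IsMinInvolution n v) (h : profile n u = profile n v) :
    u = v := by
  have hcount : levelCount n u = levelCount n v := by
    funext t
    rcases lt_or_ge 0 t with ht | ht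
    · obtain ⟨j, rfl⟩ : ∃ j : ℕ, t = j + 1 := ⟨(t - 1).toNat, by omega⟩
      rw [hu.levelCount_natCast_add_one, hv.levelCount_natCast_add_one, h]
    · obtain ⟨j, rfl⟩ : ∃ j : ℕ, t = -j := ⟨(-t).toNat, by omega⟩
      exact congrFun h j
  have hlevel : ∀ i : Fin n, level u i = level v i := by
    intro i
    refine eq_of_forall_lt_iff fun t => ?_
    have := (hu.level_lt_iff i (t + 1)).trans (by rw [hcount, ← hv.level_lt_iff i (t + 1)])
    omega
  have hrange : ∀ {u : Perm ℤ}, IsMinInvolution n u →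
      Set.range (fun i : Fin n => u ((i : ℕ) : ℤ)) =
      Set.range fun i : Fin n => ((i : ℕ) : ℤ) + n * -level u i := by
    intro u hu
    ext z
    constructor
    · rintro ⟨i, rfl⟩
      refine ⟨partner u i, ?_⟩
      simp only
      rw [level_partner hu.periodic hu.involutive, neg_neg, ← partner_add_level]
    · rintro ⟨i, rfl⟩
      exact ⟨partner u i, apply_partner hu.periodic hu.involutive i⟩
  have hfin : (fun i : Fin n => u ((i : ℕ) : ℤ)) = fun i : Fin n => v ((i : ℕ) : ℤ) := by
    refine (StrictMono.range_inj (fun i j h => hu.mono i j h) (fun i j h => hv.mono i j h)).1 ?_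
    rw [hrange hu, hrange hv]
    simp_rw [hlevel]
  ext x
  rw [← coe_residue_add (n := n) x, hu.periodic.add_mul, hv.periodic.add_mul]
  exact congrArg (· + _) (congrFun hfin (residue n x))

/-- On the window, only the levels matter in Shi's formula, since partners decrease when levels
increase. -/
theorem shiTerm_eq (i j : Fin n) : shiTerm n u ((i : ℕ) : ℤ) ((j : ℕ) : ℤ) =
    ((level u j - level u i - 1).toNat : ℤ) + ((level u i - level u j - 1).toNat : ℤ) := by
  have hn := natCast_int_pos (n := n)
  have key : ∀ i j : Fin n, i < j → (u ((j : ℕ) : ℤ) - u ((i : ℕ) : ℤ)) / n =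
      ((level u j - level u i - 1).toNat : ℤ) := by
    intro i j h
    have h1 := hu.mono i j h
    have h2 := partner_add_level u i
    have h3 := partner_add_level u j
    have h4 := (partner u i).2
    have h5 := (partner u j).2
    rw [Int.ediv_eq_iff_of_pos hn]
    rcases (hu.level_mono h.le).lt_or_eq with h6 | h6
    · have h7 := Fin.lt_def.1 (hu.partner_lt h6)
      rw [Int.toNat_of_nonneg (by omega)]
      constructor <;> nlinarith
    · rw [show (level u j - level u i - 1).toNat = 0 by omega]
      rw [h6] at h2
      push_cast
      constructor <;> omega
  have hz : ∀ i j : Fin n, i < j → (((j : ℕ) : ℤ) - ((i : ℕ) : ℤ)) / n = 0 := by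
    intro i j h
    have h1 := Fin.lt_def.1 h
    have h2 := j.2
    exact Int.ediv_eq_zero_of_lt (by omega) (by omega)
  have hneg : ∀ d : ℤ, ¬ (n : ℤ) ∣ d → (-d) / n = -(d / n) - 1 := by
    intro d hd
    have h1 := Int.emod_add_mul_ediv d n
    have h2 := Int.emod_lt_of_pos d hn
    have h3 := Int.emod_nonneg d hn.ne'
    have h4 : d % n ≠ 0 := fun h0 => hd (Int.dvd_of_emod_eq_zero h0)
    have h5 : 0 < d % n := lt_of_le_of_ne h3 h4.symm
    rw [Int.ediv_eq_iff_of_pos hn]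
    constructor <;> nlinarith
  have hlt : ∀ i j : Fin n, i < j → ((level u i - level u j - 1).toNat : ℤ) = 0 := by
    intro i j h
    have := hu.level_mono h.le
    omega
  rcases lt_trichotomy i j with h | rfl | h
  · rw [shiTerm, key i j h, hz i j h, hlt i j h, sub_zero, add_zero, abs_of_nonneg (by positivity)]
  · simp [shiTerm]
  · have hne : (((j : ℕ) : ℤ) : ZMod n) ≠ (((i : ℕ) : ℤ) : ZMod n) := by
      push_cast
      rw [Ne, ZMod.natCast_eq_natCast_iff', Nat.mod_eq_of_lt i.2, Nat.mod_eq_of_lt j.2]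
      have := Fin.lt_def.1 h
      omega
    have hne' : ((u ((j : ℕ) : ℤ) : ℤ) : ZMod n) ≠ (u ((i : ℕ) : ℤ) : ℤ) :=
      fun h => hne (hu.periodic.cast_injective h)
    rw [shiTerm, ← neg_sub (u _) (u ((j : ℕ) : ℤ)), ← neg_sub _ ((j : ℕ) : ℤ),
      hneg _ (not_dvd_sub hne), hneg _ (not_dvd_sub hne'), key j i h, hz j i h, hlt j i h, zero_add,
      show ∀ a : ℤ, -a - 1 - (-0 - 1) = -a by intro a; ring, abs_neg,
      abs_of_nonneg (by positivity)]

/-- The layer cake formula for the length of a minimal involution. -/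
theorem shiSum_eq_levelCount (N : ℕ) (hN : ∀ i : Fin n, -(N : ℤ) < level u i ∧ level u i < N) :
    shiSum n u = 2 * ∑ t ∈ Finset.Ioo (-(N : ℤ)) N,
      ((levelCount n u t : ℤ) * (levelCount n u (-t) : ℤ)) := by
  have h1 : shiSum n u = 2 * ∑ i : Fin n, ∑ j : Fin n, ((level u j - level u i - 1).toNat : ℤ) := by
    rw [shiSum_eq]
    simp_rw [hu.shiTerm_eq, Finset.sum_add_distrib]
    rw [Finset.sum_comm (f := fun i j : Fin n => ((level u i - level u j - 1).toNat : ℤ))]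
    ring
  have h2 : ∀ i j : Fin n, ((level u j - level u i - 1).toNat : ℤ) =
      ∑ t ∈ Finset.Ioo (-(N : ℤ)) N,
        (if level u i < t then 1 else 0) * (if -level u j < -t then 1 else 0) := by
    intro i j
    rw [Finset.sum_congr rfl (g := fun t => if level u i < t ∧ -level u j < -t then (1 : ℤ) else 0)
      fun t _ => by split_ifs <;> simp <;> omega]
    rw [Finset.sum_boole, ← Int.card_Ioo]
    congr 2
    ext t
    simp only [Finset.mem_Ioo, Finset.mem_filter]
    have h3 := hN i
    have h4 := hN j
    omega
  have h3 : ∀ t : ℤ, ∑ i : Fin n, (if level u i < t then (1 : ℤ) else 0) = levelCount n u t := by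
    intro t
    rw [Finset.sum_boole]
    rfl
  have h4 : ∀ t : ℤ, ∑ i : Fin n, (if -level u i < t then (1 : ℤ) else 0) = levelCount n u t := by
    intro t
    rw [Finset.sum_boole, levelCount, hu.card_level fun m => m < t]
  rw [h1]
  simp_rw [h2]
  congr 1
  rw [Finset.sum_congr rfl fun i _ => Finset.sum_comm, Finset.sum_comm]
  refine Finset.sum_congr rfl fun t _ => ?_
  rw [← h3, ← h4 (-t), Finset.sum_mul_sum]

/-- The length of a minimal involution, in terms of its profile. -/
theorem shiSum_eq_profile (N : ℕ) (hN : ∀ i : Fin n, -(N : ℤ) - 1 < level u i ∧ level u i < N + 1) :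
    shiSum n u = 2 * ((profile n u 0 : ℤ) ^ 2 +
      2 * ∑ j ∈ Finset.range N, ((n : ℤ) - profile n u j) * profile n u (j + 1)) := by
  rw [hu.shiSum_eq_levelCount (N + 1) (by push_cast; intro i; have := hN i; omega)]
  congr 1
  rw [sum_Ioo_neg]
  have h1 : ∀ j : ℕ, (levelCount n u ((j : ℤ) + 1) : ℤ) = n - profile n u j := by
    intro j
    have := hu.levelCount_add (j + 1)
    rw [show (1 : ℤ) - (j + 1) = -j by ring] at this
    unfold profile
    omega
  have h2 : ∀ j : ℕ, (levelCount n u (-((j : ℤ) + 1)) : ℤ) = profile n u (j + 1) := by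
    intro j
    simp [profile]
  have h3 : levelCount n u 0 = profile n u 0 := by simp [profile]
  simp_rw [neg_neg, h1, h2]
  rw [neg_zero, h3, pow_two, Finset.mul_sum]
  congr 1
  exact Finset.sum_congr rfl fun j _ => by ring

end IsMinInvolution

end Window

/-! ### The classification of minimal involutions -/

section Classification

variable {n : ℕ} [NeZero n]

/-- The possible profiles of minimal involutions of absolute length `k`: nonincreasing sequences
which start with `k` and are eventually zero. -/
def profileSet (k : ℕ) : Set (ℕ → ℕ) := {r | Antitone r ∧ r 0 = k ∧ ∃ N, r N = 0}

theorem le_of_mem_profileSet {k : ℕ} {r : ℕ → ℕ} (hr : r ∈ profileSet k) (j : ℕ) : r j ≤ k := by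
  rw [← hr.2.1]
  exact hr.1 (Nat.zero_le j)

/-- Every sequence in `profileSet k` is the profile of a minimal involution. It is constructed
from the level function `c`, which is in Galois connection with the counting function
`a t = #{i | c i < t}` prescribed by the profile: the level `c` starts at `a c`, and the involution
matches it in increasing order with the level `-c`, which starts at `a (-c)`. -/
theorem exists_isMinInvolution {k : ℕ} (hk : k ≤ n / 2) {r : ℕ → ℕ} (hr : r ∈ profileSet k) :
    ∃ u : Perm ℤ, IsMinInvolution n u ∧ IsMinInvolution.profile n u = r := by
  have hn := natCast_int_pos (n := n)
  have hle := le_of_mem_profileSet hr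
  obtain ⟨hanti, h0, N, hN⟩ := hr
  let a : ℤ → ℤ := fun t => if t ≤ 0 then (r (-t).toNat : ℤ) else n - r (t - 1).toNat
  have ha_sym : ∀ t, a t + a (1 - t) = n := by
    intro t
    simp only [a]
    rcases le_or_gt t 0 with h | h
    · rw [if_pos h, if_neg (by omega), show 1 - t - 1 = -t by ring]
      ring
    · rw [if_neg (by omega), if_pos (by omega), show -(1 - t) = t - 1 by ring]
      ring
  have ha_mono : Monotone a := by
    intro s t hst
    simp only [a]
    split_ifs with h1 h2 h2
    · exact_mod_cast hanti (by omega)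
    · have := hle (-s).toNat
      have := hle (t - 1).toNat
      omega
    · omega
    · have := @hanti (s - 1).toNat (t - 1).toNat (by omega)
      omega
  have ha_nonneg : ∀ t, 0 ≤ a t := by
    intro t
    simp only [a]
    split_ifs
    · positivity
    · have := hle (t - 1).toNat
      omega
  have ha_le : ∀ t, a t ≤ n := fun t => by
    have := ha_sym t
    have := ha_nonneg (1 - t)
    omega
  have ha_bot : a (-N) = 0 := by
    simp only [a]
    rw [if_pos (by omega), neg_neg, Int.toNat_natCast, hN]
    rfl
  have ha_top : a (N + 1) = n := by
    have := ha_sym (N + 1)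
    rw [show (1 : ℤ) - (N + 1) = -N by ring, ha_bot] at this
    linarith
  have hc : ∀ x : ℤ, ∃ c : ℤ, 0 ≤ x → x < n → ∀ t, c < t ↔ x < a t := by
    intro x
    by_cases hx : 0 ≤ x ∧ x < n
    · obtain ⟨c, hc1, hc2⟩ := Int.exists_greatest_of_bdd (P := fun t => a t ≤ x)
        ⟨N + 1, fun z hz => by
          by_contra hcon
          have := ha_mono (not_le.1 hcon).le
          rw [ha_top] at this
          omega⟩ ⟨-N, by rw [ha_bot]; exact hx.1⟩
      refine ⟨c, fun _ _ t => ⟨fun h => ?_, fun h => ?_⟩⟩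
      · by_contra hcon
        have := hc2 t (not_lt.1 hcon)
        omega
      · by_contra hcon
        have := ha_mono (not_lt.1 hcon)
        omega
    · exact ⟨0, fun h1 h2 => absurd ⟨h1, h2⟩ hx⟩
  choose c hc using hc
  let f : ℤ → ℤ := fun x => x + a (-c (x % n)) - a (c (x % n)) + n * c (x % n)
  have hper : ∀ x m, f (x + n * m) = f x + n * m := by
    intro x m
    simp only [f]
    rw [Int.add_mul_emod_self_left]
    ring
  have hwin : ∀ x : ℤ, 0 ≤ x → x < n → f x = x + a (-c x) - a (c x) + n * c x := by
    intro x h1 h2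
    simp only [f]
    rw [Int.emod_eq_of_lt h1 h2]
  clear_value f
  have hbound : ∀ x : ℤ, 0 ≤ x → x < n → a (c x) ≤ x ∧ x < a (c x + 1) := by
    intro x h1 h2
    refine ⟨?_, (hc x h1 h2 _).1 (by omega)⟩
    have := (hc x h1 h2 (c x)).not.1 (by omega)
    omega
  have hpartner : ∀ x : ℤ, 0 ≤ x → x < n → a (-c x) ≤ x + a (-c x) - a (c x) ∧
      x + a (-c x) - a (c x) < a (1 - c x) := by
    intro x h1 h2
    have h3 := hbound x h1 h2
    have h4 := ha_sym (c x)
    have h5 := ha_sym (c x + 1)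
    rw [show 1 - (c x + 1) = -c x by ring] at h5
    constructor <;> omega
  have hwin' : ∀ x : ℤ, 0 ≤ x → x < n → f (f x) = x := by
    intro x h1 h2
    have h3 := hpartner x h1 h2
    have h4 := ha_nonneg (-c x)
    have h5 := ha_le (1 - c x)
    rw [hwin x h1 h2, hper]
    set y := x + a (-c x) - a (c x) with hy
    have h6 : c y = -c x := by
      have e1 := (hc y (by omega) (by omega) (1 - c x)).2 h3.2
      have e2 := (hc y (by omega) (by omega) (-c x)).not.2 (by omega)
      omega
    rw [hwin y (by omega) (by omega), h6, neg_neg, hy]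
    ring
  have hinv : Function.Involutive f := by
    intro x
    have h : f (f (x % n + n * (x / n))) = x % n + n * (x / n) := by
      rw [hper, hper, hwin' _ (Int.emod_nonneg x hn.ne') (Int.emod_lt_of_pos x hn)]
    rwa [Int.emod_add_mul_ediv] at h
  have hfin : ∀ i : Fin n, (0 : ℤ) ≤ ((i : ℕ) : ℤ) ∧ ((i : ℕ) : ℤ) < n :=
    fun i => ⟨by positivity, by exact_mod_cast i.2⟩
  have hlevel : ∀ i : Fin n, level hinv.toPerm i = c ((i : ℕ) : ℤ) := by
    intro i
    obtain ⟨h1, h2⟩ := hfin i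
    have h3 := hpartner _ h1 h2
    have h4 := ha_nonneg (-c (i : ℕ))
    have h5 := ha_le (1 - c (i : ℕ))
    rw [level, Function.Involutive.coe_toPerm, hwin _ h1 h2,
      Int.add_mul_ediv_left _ _ hn.ne', Int.ediv_eq_zero_of_lt (by omega) (by omega), zero_add]
  refine ⟨hinv.toPerm, ⟨fun x => by simpa using hper x 1, hinv, fun i j hij => ?_⟩, ?_⟩
  · obtain ⟨h1, h2⟩ := hfin i
    obtain ⟨h1', h2'⟩ := hfin j
    have hij' : ((i : ℕ) : ℤ) < ((j : ℕ) : ℤ) := by exact_mod_cast hij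
    rw [Function.Involutive.coe_toPerm, hwin _ h1 h2, hwin _ h1' h2']
    have h3 : c ((i : ℕ) : ℤ) ≤ c ((j : ℕ) : ℤ) := by
      have e1 := (hc _ h1' h2' (c ((j : ℕ) : ℤ) + 1)).1 (by omega)
      have e2 := (hc _ h1 h2 (c ((j : ℕ) : ℤ) + 1)).2 (by omega)
      omega
    rcases h3.lt_or_eq with h4 | h4
    · have e1 := hpartner _ h1 h2
      have e2 := ha_le (1 - c ((i : ℕ) : ℤ))
      have e3 := hpartner _ h1' h2'
      have e4 := ha_nonneg (-c ((j : ℕ) : ℤ))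
      have e5 : (n : ℤ) * (c ((i : ℕ) : ℤ) + 1) ≤ n * c ((j : ℕ) : ℤ) :=
        mul_le_mul_of_nonneg_left (by omega) hn.le
      rw [mul_add, mul_one] at e5
      omega
    · rw [h4]
      omega
  · funext j
    unfold IsMinInvolution.profile IsMinInvolution.levelCount
    have h1 : (Finset.univ.filter fun i : Fin n => level hinv.toPerm i < -(j : ℤ)) =
        Finset.univ.filter fun i : Fin n => (i : ℕ) < r j := by
      ext i
      simp only [Finset.mem_filter, Finset.mem_univ, true_and]
      rw [hlevel, hc _ (hfin i).1 (hfin i).2]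
      simp only [a]
      rw [if_pos (by omega), neg_neg, Int.toNat_natCast]
      omega
    have := hle j
    rw [h1, Fin.card_filter_val_lt, min_eq_right (by omega)]

variable {W : Type*} [Group W] (cs : CoxeterSystem (affineMatrix n) W)

omit [NeZero n] in
theorem strictMono_window_iff {u : Perm ℤ} :
    (∀ i j : Fin n, i < j → u ((i : ℕ) : ℤ) < u ((j : ℕ) : ℤ)) ↔
      ∀ m : ℕ, m + 1 < n → u (m : ℤ) < u ((m : ℤ) + 1) := by
  constructor
  · intro h m hm
    exact_mod_cast h ⟨m, by omega⟩ ⟨m + 1, hm⟩ (by rw [Fin.lt_def]; exact Nat.lt_succ_self m)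
  · intro h i j hij
    have key : ∀ d : ℕ, (i : ℕ) + d + 1 < n → u ((i : ℕ) : ℤ) < u (((i : ℕ) + d + 1 : ℕ) : ℤ) := by
      intro d
      induction d with
      | zero => intro hd; exact_mod_cast h i hd
      | succ d ih =>
        intro hd
        have h2 := h (i + d + 1) (by omega)
        refine (ih (by omega)).trans ?_
        exact_mod_cast h2
    have h1 := Fin.lt_def.1 hij
    have h2 := key (j - i - 1) (by have := j.2; omega)
    rwa [show (i : ℕ) + (j - i - 1) + 1 = j by omega] at h2

omit [NeZero n] in
theorem mem_minCosetReps_iff (w : W) : w ∈ minCosetReps cs (finiteGenerators cs) ↔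
    ∀ i j : Fin n, i < j → toPerm cs w ((i : ℕ) : ℤ) < toPerm cs w ((j : ℕ) : ℤ) := by
  rw [strictMono_window_iff]
  constructor
  · intro h m hm
    let i : AffineIndex n := ⟨⟨m + 1, hm⟩, by omega⟩
    have h1 := (length_lt_iff cs w i ((m : ℤ) + 1) (by simp [i])).1
      (h _ ⟨i, Nat.succ_ne_zero m, rfl⟩)
    simpa using h1
  · rintro h _ ⟨i, hi, rfl⟩
    rw [length_lt_iff cs w i ((i.1 : ℕ) : ℤ) (by simp)]
    have h1 := h ((i.1 : ℕ) - 1) (by have := i.1.2; omega)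
    rw [Nat.cast_sub (by omega)] at h1
    simpa using h1

omit [NeZero n] in
theorem isMinInvolution_toPerm {w : W} (hw : w⁻¹ = w)
    (hmin : w ∈ minCosetReps cs (finiteGenerators cs)) : IsMinInvolution n (toPerm cs w) :=
  ⟨isPeriodic_toPerm cs w, toPerm_involutive cs hw, (mem_minCosetReps_iff cs w).1 hmin⟩

theorem absoluteLength_eq_profile {w : involutions W}
    (hw : IsMinInvolution n (toPerm cs (w : W))) :
    absoluteLength cs w = IsMinInvolution.profile n (toPerm cs (w : W)) 0 := by
  have := hw.card_fixedClasses
  unfold absoluteLength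
  omega

/-- The minimal involutions of absolute length `k` correspond to their profiles. -/
noncomputable def profileEquiv {k : ℕ} (hk : k ≤ n / 2) :
    {w : involutions W // (w : W) ∈ minCosetReps cs (finiteGenerators cs) ∧
      absoluteLength cs w = k} ≃ profileSet k :=
  Equiv.ofBijective (fun w => ⟨IsMinInvolution.profile n (toPerm cs (w.1 : W)),
    IsMinInvolution.profile_antitone,
    by rw [← absoluteLength_eq_profile cs (isMinInvolution_toPerm cs w.1.2 w.2.1), w.2.2],
    IsMinInvolution.exists_profile_eq_zero _⟩) <| by
  constructor
  · intro w v h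
    have h1 := congrArg Subtype.val h
    exact Subtype.ext (Subtype.ext (toPerm_injective cs
      ((isMinInvolution_toPerm cs w.1.2 w.2.1).ext_profile
        (isMinInvolution_toPerm cs v.1.2 v.2.1) h1)))
  · rintro ⟨r, hr⟩
    obtain ⟨u, hu, hur⟩ := exists_isMinInvolution hk hr
    obtain ⟨w, rfl⟩ := exists_toPerm_eq cs hu.periodic
      (displacement_of_involutive hu.periodic hu.involutive)
    have hw : w⁻¹ = w := by
      rw [_root_.inv_eq_iff_mul_eq_one]
      apply toPerm_injective cs
      ext x
      rw [map_mul, Perm.mul_apply, hu.involutive, map_one, Perm.one_apply]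
    refine ⟨⟨⟨w, hw⟩, (mem_minCosetReps_iff cs w).2 hu.mono, ?_⟩, Subtype.ext hur⟩
    rw [absoluteLength_eq_profile cs hu, hur, hr.2.1]

theorem profileEquiv_apply {k : ℕ} (hk : k ≤ n / 2)
    (w : {w : involutions W // (w : W) ∈ minCosetReps cs (finiteGenerators cs) ∧
      absoluteLength cs w = k}) :
    (profileEquiv cs hk w : ℕ → ℕ) = IsMinInvolution.profile n (toPerm cs (w.1 : W)) := rfl

end Classification

/-! ### Counting permutations by inversions -/

section Inversions

/-- The number of inversions of a permutation of a finite linear order. -/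
def invCount {α : Type*} [Fintype α] [LinearOrder α] (σ : Perm α) : ℕ :=
  ∑ i : α, ∑ j : α, if i < j ∧ σ j < σ i then 1 else 0

/-- The polynomial `[1]_q [2]_q ⋯ [m]_q`, evaluated at an element of a semiring. -/
def gaussFactorial {R : Type*} [CommSemiring R] (q : R) (m : ℕ) : R :=
  ∏ i ∈ Finset.range m, ∑ l ∈ Finset.range (i + 1), q ^ l

/-- The permutation of `Fin (m + 1)` which maps `0` to `p` and is order isomorphic to `e` on the
remaining elements. -/
def insertPerm {m : ℕ} (p : Fin (m + 1)) (e : Perm (Fin m)) : Perm (Fin (m + 1)) :=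
  p.cycleRange.symm * Perm.decomposeFin.symm (0, e)

theorem insertPerm_zero {m : ℕ} (p : Fin (m + 1)) (e : Perm (Fin m)) : insertPerm p e 0 = p := by
  simp [insertPerm]

theorem insertPerm_succ {m : ℕ} (p : Fin (m + 1)) (e : Perm (Fin m)) (i : Fin m) :
    insertPerm p e i.succ = p.succAbove (e i) := by
  simp [insertPerm]

theorem insertPerm_bijective (m : ℕ) :
    Function.Bijective fun x : Fin (m + 1) × Perm (Fin m) => insertPerm x.1 x.2 := by
  rw [Fintype.bijective_iff_injective_and_card]
  constructor
  · rintro ⟨p, e⟩ ⟨p', e'⟩ h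
    have h' : insertPerm p e = insertPerm p' e' := h
    obtain rfl : p = p' := by rw [← insertPerm_zero p e, h', insertPerm_zero]
    congr 1
    ext i
    have h2 := insertPerm_succ p e i
    rw [h', insertPerm_succ] at h2
    rw [Fin.succAbove_right_injective h2]
  · simp [Fintype.card_perm, Nat.factorial_succ]

theorem invCount_insertPerm {m : ℕ} (p : Fin (m + 1)) (e : Perm (Fin m)) :
    invCount (insertPerm p e) = p + invCount e := by
  unfold invCount
  rw [Fin.sum_univ_succ]
  congr 1
  · rw [Fin.sum_univ_succ]
    simp only [lt_self_iff_false, false_and, if_false, zero_add, Fin.succ_pos, true_and,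
      insertPerm_zero, insertPerm_succ]
    rw [Equiv.sum_comp e fun j => if p.succAbove j < p then 1 else 0]
    simp only [Fin.succAbove_lt_iff_castSucc_lt]
    simp only [Fin.lt_def, Fin.val_castSucc]
    rw [← Finset.card_filter, Fin.card_filter_val_lt, min_eq_right (by omega)]
  · refine Finset.sum_congr rfl fun i _ => ?_
    rw [Fin.sum_univ_succ]
    simp only [Fin.not_lt_zero, false_and, if_false, zero_add, Fin.succ_lt_succ_iff,
      insertPerm_succ]
    refine Finset.sum_congr rfl fun j _ => ?_
    simp only [(Fin.strictMono_succAbove p).lt_iff_lt]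

theorem sum_pow_invCount_fin {R : Type*} [CommSemiring R] (q : R) (m : ℕ) :
    ∑ σ : Perm (Fin m), q ^ invCount σ = gaussFactorial q m := by
  induction m with
  | zero => simp [gaussFactorial, invCount]
  | succ m ih =>
    rw [← (insertPerm_bijective m).sum_comp fun σ => q ^ invCount σ, Fintype.sum_prod_type,
      gaussFactorial, Finset.prod_range_succ]
    simp_rw [invCount_insertPerm, pow_add]
    rw [← Finset.sum_mul_sum, ih, mul_comm, Fin.sum_univ_eq_sum_range fun l => q ^ l]
    rfl

theorem sum_pow_invCount {R : Type*} [CommSemiring R] (q : R) {α : Type*} [Fintype α]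
    [LinearOrder α] [Fintype (Perm α)] :
    ∑ σ : Perm α, q ^ invCount σ = gaussFactorial q (Fintype.card α) := by
  rw [← sum_pow_invCount_fin]
  let e := Fintype.orderIsoFinOfCardEq α rfl
  rw [← Equiv.sum_comp e.toEquiv.permCongr]
  refine Finset.sum_congr rfl fun σ _ => ?_
  congr 1
  unfold invCount
  rw [← Equiv.sum_comp e.toEquiv]
  refine Finset.sum_congr rfl fun i _ => ?_
  rw [← Equiv.sum_comp e.toEquiv]
  refine Finset.sum_congr rfl fun j _ => ?_
  simp [Equiv.permCongr_apply]

end Inversions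

/-! ### Permutations which commute with a minimal involution -/

section Blocks

variable {n : ℕ} [NeZero n]

/-- The elements of the window which lie on a given level. -/
abbrev Block (n : ℕ) [NeZero n] (u : Perm ℤ) (l : ℤ) : Type := {i : Fin n // level u i = l}

/-- The permutations of the window which preserve the levels and commute with the matching of
opposite levels. -/
def BlockPerm (n : ℕ) [NeZero n] (u : Perm ℤ) (σ : Perm (Fin n)) : Prop :=
  (∀ i, level u (σ i) = level u i) ∧ ∀ i, σ (partner u i) = partner u (σ i)

/-- The restriction of a level-preserving permutation to a level. -/
def BlockPerm.restrict {u : Perm ℤ} {σ : Perm (Fin n)} (hσ : BlockPerm n u σ) (l : ℤ) :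
    Perm (Block n u l) :=
  σ.subtypePerm fun i => by rw [hσ.1]

theorem BlockPerm.coe_restrict {u : Perm ℤ} {σ : Perm (Fin n)} (hσ : BlockPerm n u σ) {l : ℤ}
    (x : Block n u l) : ((hσ.restrict l x : Block n u l) : Fin n) = σ x := rfl

namespace IsMinInvolution

variable {u : Perm ℤ} (hu : IsMinInvolution n u)

include hu

theorem partner_lt_iff {i j : Fin n} (h : level u i = level u j) :
    partner u i < partner u j ↔ i < j := by
  have hi := partner_add_level u i
  have hj := partner_add_level u j
  rw [h] at hi
  constructor
  · intro h1
    by_contra h2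
    rcases (not_lt.1 h2).lt_or_eq with h3 | h3
    · have := hu.mono _ _ h3
      rw [Fin.lt_def] at h1
      omega
    · rw [h3] at h1
      exact lt_irrefl _ h1
  · intro h1
    have := hu.mono _ _ h1
    rw [Fin.lt_def]
    omega

/-- The inversions of a level-preserving permutation lie within the levels. -/
theorem invCount_eq_sum_levels {σ : Perm (Fin n)} (hσ : BlockPerm n u σ) (N : ℕ)
    (hN : ∀ i : Fin n, -(N : ℤ) - 1 < level u i ∧ level u i < N + 1) :
    invCount σ = ∑ l ∈ Finset.Ioo (-((N + 1 : ℕ) : ℤ)) ((N + 1 : ℕ) : ℤ),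
      invCount (hσ.restrict l) := by
  have h1 : ∀ l : ℤ, invCount (hσ.restrict l) = ∑ i : Fin n, ∑ j : Fin n,
      if level u i = l then if level u j = l then if i < j ∧ σ j < σ i then 1 else 0
        else 0 else 0 := by
    intro l
    have h2 : ∀ f : Fin n → ℕ, ∑ x : Block n u l, f x =
        ∑ i : Fin n, if level u i = l then f i else 0 := by
      intro f
      rw [← Finset.sum_filter]
      exact (Finset.sum_subtype _ (by simp) f).symm
    unfold invCount
    have h3 := h2 fun i => ∑ x : Block n u l, if i < x ∧ σ x < σ i then 1 else 0
    refine Eq.trans h3 (Finset.sum_congr rfl fun i _ => ?_)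
    rw [h2 fun j => if i < j ∧ σ j < σ i then 1 else 0]
    split_ifs <;> simp
  simp_rw [h1]
  rw [Finset.sum_comm]
  unfold invCount
  refine Finset.sum_congr rfl fun i _ => ?_
  rw [Finset.sum_comm]
  refine Finset.sum_congr rfl fun j _ => ?_
  have hmem : level u i ∈ Finset.Ioo (-((N + 1 : ℕ) : ℤ)) ((N + 1 : ℕ) : ℤ) := by
    rw [Finset.mem_Ioo]
    have := hN i
    push_cast
    omega
  rw [Finset.sum_ite_eq, if_pos hmem]
  by_cases hij : level u j = level u i
  · rw [if_pos hij]
  · rw [if_neg hij, if_neg]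
    rintro ⟨h2, h3⟩
    have h4 := hu.level_mono h2.le
    have h5 := hu.level_mono h3.le
    rw [hσ.1, hσ.1] at h5
    omega

/-- A permutation which commutes with the matching has the same inversions on opposite levels. -/
theorem invCount_restrict_neg {σ : Perm (Fin n)} (hσ : BlockPerm n u σ) (l : ℤ) :
    invCount (hσ.restrict (-l)) = invCount (hσ.restrict l) := by
  have hp := partner_involutive (n := n) hu.periodic hu.involutive
  have hl := level_partner (n := n) hu.periodic hu.involutive
  let e : Block n u l ≃ Block n u (-l) :=
    hp.toPerm.subtypeEquiv fun i => by
      rw [Function.Involutive.coe_toPerm, hl, neg_inj]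
  have he : ∀ x : Block n u l, ((e x : Block n u (-l)) : Fin n) = partner u x := fun _ => rfl
  unfold invCount
  rw [← Equiv.sum_comp e]
  refine Finset.sum_congr rfl fun i _ => ?_
  rw [← Equiv.sum_comp e]
  refine Finset.sum_congr rfl fun j _ => ?_
  congr 1
  change ((e i : Fin n) < (e j : Fin n) ∧
      (hσ.restrict (-l) (e j) : Fin n) < (hσ.restrict (-l) (e i) : Fin n)) =
    ((i : Fin n) < (j : Fin n) ∧ (hσ.restrict l j : Fin n) < (hσ.restrict l i : Fin n))
  simp only [hσ.coe_restrict, he, hσ.2]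
  rw [hu.partner_lt_iff (by rw [i.2, j.2]), hu.partner_lt_iff (by rw [hσ.1, hσ.1, i.2, j.2])]

theorem invCount_eq {σ : Perm (Fin n)} (hσ : BlockPerm n u σ) (N : ℕ)
    (hN : ∀ i : Fin n, -(N : ℤ) - 1 < level u i ∧ level u i < N + 1) :
    invCount σ = invCount (hσ.restrict 0) +
      ∑ j ∈ Finset.range N, 2 * invCount (hσ.restrict ((j : ℤ) + 1)) := by
  have h := sum_Ioo_neg (fun l => (invCount (hσ.restrict l) : ℤ)) N
  rw [← Nat.cast_sum, ← hu.invCount_eq_sum_levels hσ N hN] at h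
  simp_rw [hu.invCount_restrict_neg hσ] at h
  zify
  rw [h]
  congr 1
  exact Finset.sum_congr rfl fun j _ => by ring

omit hu in
theorem coe_family_eq {N : ℕ} (τ : ∀ j : Fin (N + 1), Perm (Block n u ((j : ℕ) : ℤ)))
    {j j' : Fin (N + 1)} (h : j = j') (i : Fin n) (hi : level u i = ((j : ℕ) : ℤ))
    (hi' : level u i = ((j' : ℕ) : ℤ)) : ((τ j ⟨i, hi⟩ : Block n u _) : Fin n) = τ j' ⟨i, hi'⟩ := by
  subst h
  rfl

/-- A family of permutations of the nonnegative levels extends to a permutation of the window which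
commutes with the matching. -/
theorem exists_blockPerm {N : ℕ} (hN : ∀ i : Fin n, -(N : ℤ) - 1 < level u i ∧ level u i < N + 1)
    (τ : ∀ j : Fin (N + 1), Perm (Block n u ((j : ℕ) : ℤ))) :
    ∃ σ : Perm (Fin n), BlockPerm n u σ ∧
      ∀ (j : Fin (N + 1)) (x : Block n u ((j : ℕ) : ℤ)), σ x = τ j x := by
  have hp := partner_involutive (n := n) hu.periodic hu.involutive
  have hl := level_partner (n := n) hu.periodic hu.involutive
  have hfix : ∀ i : Fin n, level u i = 0 → partner u i = i := by
    intro i hi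
    have h1 := (hu.apply_eq_self_iff i).2 hi
    rw [partner, h1]
    simpa using residue_add_mul i 0
  let g : (∀ j : Fin (N + 1), Perm (Block n u ((j : ℕ) : ℤ))) → Fin n → Fin n := fun τ i =>
    if h : 0 ≤ level u i then
      ((τ ⟨(level u i).toNat, by have := hN i; omega⟩
        ⟨i, (Int.toNat_of_nonneg h).symm⟩ : Block n u _) : Fin n)
    else i
  have hg : ∀ τ (j : Fin (N + 1)) (x : Block n u ((j : ℕ) : ℤ)), g τ x = τ j x := by
    intro τ j x
    have hx := x.2
    simp only [g]
    rw [dif_pos (by rw [hx]; positivity)]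
    exact coe_family_eq τ (Fin.ext (by simp [hx])) x.1 _ x.2
  have hex : ∀ i : Fin n, 0 ≤ level u i →
      ∃ (j : Fin (N + 1)) (x : Block n u ((j : ℕ) : ℤ)), (x : Fin n) = i := fun i h =>
    ⟨⟨(level u i).toNat, by have := hN i; omega⟩, ⟨i, (Int.toNat_of_nonneg h).symm⟩, rfl⟩
  have hglev : ∀ τ i, 0 ≤ level u i → level u (g τ i) = level u i := by
    intro τ i h
    obtain ⟨j, x, rfl⟩ := hex i h
    rw [hg, (τ j x).2, x.2]
  let f : (∀ j : Fin (N + 1), Perm (Block n u ((j : ℕ) : ℤ))) → Fin n → Fin n := fun τ i =>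
    if 0 ≤ level u i then g τ i else partner u (g τ (partner u i))
  have hf : ∀ τ i, 0 ≤ level u i → f τ i = g τ i := fun τ i h => if_pos h
  have hflev : ∀ τ i, level u (f τ i) = level u i := by
    intro τ i
    simp only [f]
    split_ifs with h
    · exact hglev τ i h
    · rw [hl, hglev _ _ (by rw [hl]; omega), hl, neg_neg]
  have hfp : ∀ τ i, f τ (partner u i) = partner u (f τ i) := by
    intro τ i
    simp only [f]
    rcases lt_trichotomy (level u i) 0 with h | h | h
    · rw [if_pos (by rw [hl]; omega), if_neg (by omega), hp]
    · rw [if_pos (by rw [hl]; omega), if_pos (by omega), hfix i h,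
        hfix _ (by rw [hglev _ _ h.ge, h])]
    · rw [if_neg (by rw [hl]; omega), if_pos (by omega), hp]
  clear_value f g
  have hinv : ∀ τ τ' : (∀ j : Fin (N + 1), Perm (Block n u ((j : ℕ) : ℤ))),
      (∀ j x, τ' j (τ j x) = x) → ∀ i, f τ' (f τ i) = i := by
    intro τ τ' h
    have key : ∀ i, 0 ≤ level u i → f τ' (f τ i) = i := by
      intro i hi
      rw [hf _ (f τ i) (by rw [hflev]; exact hi), hf _ _ hi]
      obtain ⟨j, x, rfl⟩ := hex i hi
      rw [hg, hg, h]
    intro i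
    rcases le_or_gt 0 (level u i) with hi | hi
    · exact key i hi
    · have := key (partner u i) (by rw [hl]; omega)
      rw [hfp, hfp] at this
      exact hp.injective this
  let τ' : ∀ j : Fin (N + 1), Perm (Block n u ((j : ℕ) : ℤ)) := fun j => (τ j)⁻¹
  let σ : Perm (Fin n) :=
    { toFun := f τ
      invFun := f τ'
      left_inv := hinv τ τ' fun j x => (τ j).symm_apply_apply x
      right_inv := hinv τ' τ fun j x => (τ j).apply_symm_apply x }
  refine ⟨σ, ⟨hflev τ, hfp τ⟩, fun j x => ?_⟩
  change f τ x = τ j x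
  rw [hf _ _ (by rw [x.2]; positivity), hg]

/-- The inversion polynomial of the permutations which commute with a minimal involution: the level
zero is permuted freely, and each other level carries its opposite level along. -/
theorem sum_blockPerm {R : Type*} [CommSemiring R] (q : R) {N : ℕ}
    (hN : ∀ i : Fin n, -(N : ℤ) - 1 < level u i ∧ level u i < N + 1)
    [DecidablePred (BlockPerm n u)] :
    ∑ σ ∈ Finset.univ.filter (BlockPerm n u), q ^ invCount σ =
      gaussFactorial q (Fintype.card (Block n u 0)) *
        ∏ j ∈ Finset.range N, gaussFactorial (q ^ 2) (Fintype.card (Block n u ((j : ℤ) + 1))) := by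
  let wt : Fin (N + 1) → R := fun j => if j = 0 then q else q ^ 2
  have hbij : Function.Bijective
      fun (σ : {σ : Perm (Fin n) // BlockPerm n u σ}) (j : Fin (N + 1)) =>
        σ.2.restrict ((j : ℕ) : ℤ) := by
    constructor
    · rintro ⟨σ, hσ⟩ ⟨σ', hσ'⟩ h
      apply Subtype.ext
      have h1 : ∀ i, 0 ≤ level u i → σ i = σ' i := by
        intro i hi
        have := congrFun h ⟨(level u i).toNat, by have := hN i; omega⟩
        have := congrArg Subtype.val (Equiv.congr_fun this ⟨i, (Int.toNat_of_nonneg hi).symm⟩)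
        exact this
      ext i
      rcases le_or_gt 0 (level u i) with hi | hi
      · rw [h1 i hi]
      · have := h1 (partner u i) (by
          rw [level_partner hu.periodic hu.involutive]; omega)
        rw [hσ.2, hσ'.2] at this
        rw [(partner_involutive hu.periodic hu.involutive).injective this]
    · intro τ
      obtain ⟨σ, hσ, h⟩ := hu.exists_blockPerm hN τ
      refine ⟨⟨σ, hσ⟩, ?_⟩
      funext j
      ext x
      exact congrArg Fin.val (h j x)
  have hwt : ∀ σ : {σ : Perm (Fin n) // BlockPerm n u σ}, q ^ invCount σ.1 =
      ∏ j : Fin (N + 1), wt j ^ invCount (σ.2.restrict ((j : ℕ) : ℤ)) := by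
    intro σ
    rw [hu.invCount_eq σ.2 N hN, Fin.prod_univ_succ, pow_add, ← Finset.prod_pow_eq_pow_sum,
      ← Fin.prod_univ_eq_prod_range fun j => q ^ (2 * invCount (σ.2.restrict ((j : ℤ) + 1)))]
    simp only [wt, if_true, Fin.succ_ne_zero, if_false, ← pow_mul, Fin.val_zero, Fin.val_succ]
    push_cast
    rfl
  rw [Finset.sum_subtype (p := BlockPerm n u) (Finset.univ.filter (BlockPerm n u)) (by simp)]
  simp_rw [hwt]
  rw [hbij.sum_comp fun τ : (∀ j : Fin (N + 1), Perm (Block n u ((j : ℕ) : ℤ))) =>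
    ∏ j : Fin (N + 1), wt j ^ invCount (τ j)]
  rw [← Fintype.prod_sum fun (j : Fin (N + 1)) (τ : Perm (Block n u ((j : ℕ) : ℤ))) =>
    wt j ^ invCount τ]
  simp_rw [sum_pow_invCount]
  rw [Fin.prod_univ_succ, ← Fin.prod_univ_eq_prod_range fun j =>
    gaussFactorial (q ^ 2) (Fintype.card (Block n u ((j : ℤ) + 1)))]
  simp only [wt, if_true, Fin.succ_ne_zero, if_false, Fin.val_zero, Fin.val_succ]
  push_cast
  rfl

theorem card_block_succ (j : ℕ) :
    Fintype.card (Block n u ((j : ℤ) + 1)) = profile n u j - profile n u (j + 1) := by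
  rw [Fintype.card_subtype, hu.card_level fun m => m = (j : ℤ) + 1]
  have h : profile n u j = (Finset.univ.filter fun i : Fin n => -level u i = (j : ℤ) + 1).card +
      profile n u (j + 1) := by
    unfold profile levelCount
    rw [Finset.card_filter, Finset.card_filter, Finset.card_filter, ← Finset.sum_add_distrib]
    refine Finset.sum_congr rfl fun i _ => ?_
    split_ifs <;> omega
  omega

theorem card_block_zero : Fintype.card (Block n u 0) = n - 2 * profile n u 0 := by
  have h := hu.card_fixedClasses
  rw [card_fixedClasses_eq] at h
  simp_rw [hu.apply_eq_self_iff] at h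
  rw [Fintype.card_subtype]
  omega

end IsMinInvolution

end Blocks

/-! ### Parabolic subgroups of the finite part -/

section Parabolic

variable {n : ℕ} [NeZero n]

/-- The periodic extension of a permutation of the window. -/
def windowPerm (σ : Perm (Fin n)) : Perm ℤ where
  toFun x := (σ (residue n x) : ℕ) + n * (x / n)
  invFun x := (σ⁻¹ (residue n x) : ℕ) + n * (x / n)
  left_inv x := by
    dsimp only
    rw [residue_add_mul, add_mul_ediv_of_fin]
    simpa using coe_residue_add (n := n) x
  right_inv x := by
    dsimp only
    rw [residue_add_mul, add_mul_ediv_of_fin]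
    simpa using coe_residue_add (n := n) x

theorem windowPerm_apply (σ : Perm (Fin n)) (x : ℤ) :
    windowPerm σ x = (σ (residue n x) : ℕ) + n * (x / n) := rfl

theorem windowPerm_add_mul (σ : Perm (Fin n)) (i : Fin n) (k : ℤ) :
    windowPerm σ ((i : ℕ) + n * k) = (σ i : ℕ) + n * k := by
  rw [windowPerm_apply, residue_add_mul, add_mul_ediv_of_fin]

theorem windowPerm_coe (σ : Perm (Fin n)) (i : Fin n) :
    windowPerm σ ((i : ℕ) : ℤ) = (σ i : ℕ) := by
  simpa using windowPerm_add_mul σ i 0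

theorem isPeriodic_windowPerm (σ : Perm (Fin n)) : IsPeriodic n (windowPerm σ) := by
  intro x
  rw [← coe_residue_add (n := n) x, add_assoc, ← mul_add_one, windowPerm_add_mul,
    windowPerm_add_mul]
  ring

theorem displacement_windowPerm (σ : Perm (Fin n)) : displacement n (windowPerm σ) = 0 := by
  rw [displacement_eq]
  simp_rw [windowPerm_coe]
  rw [Finset.sum_sub_distrib, Equiv.sum_comp σ fun i : Fin n => ((i : ℕ) : ℤ), sub_self]

theorem windowPerm_injective : Function.Injective (windowPerm (n := n)) := by
  intro σ τ h
  ext i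
  have h1 := windowPerm_coe σ i
  rw [h, windowPerm_coe] at h1
  exact_mod_cast h1.symm

theorem shiSum_windowPerm (σ : Perm (Fin n)) : shiSum n (windowPerm σ) = 2 * invCount σ := by
  have hn := natCast_int_pos (n := n)
  have h0 : ∀ i j : Fin n, i ≤ j → (((j : ℕ) : ℤ) - ((i : ℕ) : ℤ)) / n = 0 := by
    intro i j h
    have h1 := Fin.le_def.1 h
    have h2 := j.2
    exact Int.ediv_eq_zero_of_lt (by omega) (by omega)
  have h1 : ∀ i j : Fin n, j < i → (((j : ℕ) : ℤ) - ((i : ℕ) : ℤ)) / n = -1 := by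
    intro i j h
    have h1 := Fin.lt_def.1 h
    have h2 := i.2
    rw [Int.ediv_eq_iff_of_pos hn]
    constructor <;> omega
  have key : ∀ i j : Fin n, shiTerm n (windowPerm σ) ((i : ℕ) : ℤ) ((j : ℕ) : ℤ) =
      (if i < j ∧ σ j < σ i then 1 else 0) + (if j < i ∧ σ i < σ j then 1 else 0) := by
    intro i j
    rw [shiTerm, windowPerm_coe, windowPerm_coe]
    rcases lt_trichotomy i j with h | rfl | h
    · rw [h0 i j h.le, if_neg (c := j < i ∧ _) (fun h' => lt_asymm h h'.1)]
      by_cases h' : σ j < σ i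
      · rw [h1 _ _ h', if_pos ⟨h, h'⟩]; norm_num
      · rw [h0 _ _ (not_lt.1 h'), if_neg (fun h'' => h' h''.2)]; norm_num
    · simp
    · rw [h1 i j h, if_neg (c := i < j ∧ _) (fun h' => lt_asymm h h'.1)]
      by_cases h' : σ i < σ j
      · rw [h0 _ _ h'.le, if_pos ⟨h, h'⟩]; norm_num
      · have h2 : σ j < σ i := lt_of_le_of_ne (not_lt.1 h') (σ.injective.ne h.ne)
        rw [h1 _ _ h2, if_neg (fun h'' => h' h''.2)]; norm_num
  rw [shiSum_eq]
  simp_rw [key, Finset.sum_add_distrib]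
  rw [Finset.sum_comm (f := fun i j : Fin n => if j < i ∧ σ i < σ j then (1 : ℤ) else 0), ← two_mul,
    invCount]
  push_cast
  rfl

variable {W : Type*} [Group W] (cs : CoxeterSystem (affineMatrix n) W)

theorem length_eq_invCount {x : W} {σ : Perm (Fin n)} (h : toPerm cs x = windowPerm σ) :
    cs.length x = invCount σ := by
  have h1 := two_mul_length cs x
  rw [h, shiSum_windowPerm] at h1
  omega

/-- The simple generators which exchange neighbours `i - 1` and `i` in the window on which the
function `c` takes the same value. -/
def levelGenerators (c : Fin n → ℤ) : Set W :=
  {s | ∃ i : AffineIndex n, ∃ j : Fin n, (i.1 : ℕ) = j + 1 ∧ c j = c i.1 ∧ s = cs.simple i}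

omit [NeZero n] in
theorem finiteGenerators_eq : finiteGenerators cs = levelGenerators cs fun _ => 0 := by
  ext s
  constructor
  · rintro ⟨i, hi, rfl⟩
    exact ⟨i, ⟨(i.1 : ℕ) - 1, by have := i.1.2; omega⟩, by simp; omega, rfl, rfl⟩
  · rintro ⟨i, j, hij, -, rfl⟩
    exact ⟨i, by omega, rfl⟩

/-- The invariant of the parabolic subgroup attached to `c`: the translate of the window in which
an integer lies, and the value of `c` at its residue. -/
def windowLevel (c : Fin n → ℤ) (x : ℤ) : ℤ × ℤ := (x / n, c (residue n x))

theorem windowLevel_add_mul (c : Fin n → ℤ) (i : Fin n) (k : ℤ) :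
    windowLevel c ((i : ℕ) + n * k) = (k, c i) := by
  rw [windowLevel, add_mul_ediv_of_fin, residue_add_mul]

theorem windowLevel_coe (c : Fin n → ℤ) (i : Fin n) : windowLevel c ((i : ℕ) : ℤ) = (0, c i) := by
  simpa using windowLevel_add_mul c i 0

theorem windowLevel_swapFun {c : Fin n → ℤ} {i : AffineIndex n} {j : Fin n}
    (hij : (i.1 : ℕ) = j + 1) (h : c j = c i.1) (x : ℤ) :
    windowLevel c (swapFun ((i.1 : ℕ) : ZMod n) x) = windowLevel c x := by
  by_cases hx : (x : ZMod n) = ((i.1 : ℕ) : ZMod n)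
  · obtain ⟨k, rfl⟩ := exists_eq_add_mul (n := n) (x := ((i.1 : ℕ) : ℤ)) (y := x)
      (by rw [hx]; simp)
    rw [swapFun_of_eq hx, windowLevel_add_mul, show ((i.1 : ℕ) : ℤ) + n * k - 1 = (j : ℕ) + n * k by
      rw [hij]; push_cast; ring, windowLevel_add_mul, h]
  · by_cases hx' : (x : ZMod n) + 1 = ((i.1 : ℕ) : ZMod n)
    · obtain ⟨k, rfl⟩ := exists_eq_add_mul (n := n) (x := ((j : ℕ) : ℤ)) (y := x) (by
        rw [eq_comm, ← add_left_inj 1, hx', hij]; simp)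
      rw [swapFun_of_add_one_eq i.2 hx', windowLevel_add_mul,
        show ((j : ℕ) : ℤ) + n * k + 1 = (i.1 : ℕ) + n * k by rw [hij]; push_cast; ring,
        windowLevel_add_mul, h]
    · rw [swapFun_of_ne hx hx']

/-- If `c` is monotone, the parabolic subgroup of the generators within the fibres of `c` is the
stabilizer of these fibres and of the windows. -/
theorem mem_closure_levelGenerators_iff {c : Fin n → ℤ} (hc : Monotone c) (x : W) :
    x ∈ Subgroup.closure (levelGenerators cs c) ↔
      ∀ y, windowLevel c (toPerm cs x y) = windowLevel c y := by
  constructor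
  · intro hx
    induction hx using Subgroup.closure_induction with
    | mem x hx =>
      obtain ⟨i, j, hij, h, rfl⟩ := hx
      intro y
      rw [toPerm_simple, affineSwap_apply, windowLevel_swapFun hij h]
    | one => intro y; rw [map_one, Perm.one_apply]
    | mul x y _ _ hx hy => intro z; rw [map_mul, Perm.mul_apply, hx, hy]
    | inv x _ hx =>
      intro y
      rw [← hx, ← Perm.mul_apply, ← map_mul, mul_inv_cancel, map_one, Perm.one_apply]
  · intro hx
    induction hl : cs.length x using Nat.strong_induction_on generalizing x with
    | _ l ih =>
    subst hl
    by_cases hx1 : x = 1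
    · rw [hx1]; exact one_mem _
    obtain ⟨i, hi⟩ := cs.exists_rightDescent_of_ne_one hx1
    unfold CoxeterSystem.IsRightDescent at hi
    have hlt := (length_lt_iff cs x i ((i.1 : ℕ) : ℤ) (by simp)).not.1 (by omega)
    have hlt' : toPerm cs x ((i.1 : ℕ) : ℤ) < toPerm cs x (((i.1 : ℕ) : ℤ) - 1) :=
      lt_of_le_of_ne (not_lt.1 hlt) ((toPerm cs x).injective.ne (by omega))
    have h1 := hx ((i.1 : ℕ) : ℤ)
    have h2 := hx (((i.1 : ℕ) : ℤ) - 1)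
    have hdiv := Int.ediv_le_ediv (natCast_int_pos (n := n)) hlt'.le
    rw [windowLevel_coe] at h1
    have h1a := congrArg Prod.fst h1
    have h1b := congrArg Prod.snd h1
    simp only [windowLevel] at h1a h1b
    -- The generator `s_0` cannot be a descent, since it moves elements out of the window.
    have hi0 : (i.1 : ℕ) ≠ 0 := by
      intro h0
      have h2a := congrArg Prod.fst h2
      simp only [windowLevel] at h2a
      rw [h0] at h2a hdiv h1a
      push_cast at h2a hdiv h1a
      rw [neg_one_ediv i.2] at h2a
      omega
    let j : Fin n := ⟨(i.1 : ℕ) - 1, by have := i.1.2; omega⟩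
    have hj : (i.1 : ℕ) = j + 1 := by simp only [j]; omega
    have hj' : ((i.1 : ℕ) : ℤ) - 1 = (j : ℕ) := by rw [hj]; push_cast; ring
    rw [hj', windowLevel_coe] at h2
    rw [hj'] at hlt'
    have h2a := congrArg Prod.fst h2
    have h2b := congrArg Prod.snd h2
    simp only [windowLevel] at h2a h2b
    have h3 : c j = c i.1 := by
      apply le_antisymm
      · exact hc (by rw [Fin.le_def]; omega)
      · rw [← h1b, ← h2b]
        apply hc
        rw [Fin.le_def]
        have e1 := coe_residue_add (n := n) (toPerm cs x ((i.1 : ℕ) : ℤ))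
        have e2 := coe_residue_add (n := n) (toPerm cs x ((j : ℕ) : ℤ))
        rw [h1a, mul_zero, add_zero] at e1
        rw [h2a, mul_zero, add_zero] at e2
        omega
    have hs : cs.simple i ∈ Subgroup.closure (levelGenerators cs c) :=
      Subgroup.subset_closure ⟨i, j, hj, h3, rfl⟩
    have h4 := ih _ hi (x * cs.simple i) (fun y => by
      rw [toPerm_mul_simple_apply, hx, windowLevel_swapFun hj h3]) rfl
    have h5 := mul_mem h4 hs
    rwa [cs.simple_mul_simple_cancel_right] at h5

/-- Elements which preserve the windows come from permutations of the window. -/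
theorem exists_windowPerm_eq {c : Fin n → ℤ} {u : Perm ℤ} (hu : IsPeriodic n u)
    (h : ∀ y, windowLevel c (u y) = windowLevel c y) :
    ∃ σ : Perm (Fin n), u = windowPerm σ ∧ ∀ i, c (σ i) = c i := by
  have h' : ∀ y, windowLevel c (u⁻¹ y) = windowLevel c y := fun y => by
    rw [← h, ← Perm.mul_apply, mul_inv_cancel, Perm.one_apply]
  have key : ∀ v : Perm ℤ, (∀ y, windowLevel c (v y) = windowLevel c y) → ∀ i : Fin n,
      ((residue n (v ((i : ℕ) : ℤ)) : ℕ) : ℤ) = v ((i : ℕ) : ℤ) := by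
    intro v hv i
    have h1 := congrArg Prod.fst (hv ((i : ℕ) : ℤ))
    rw [windowLevel_coe] at h1
    simp only [windowLevel] at h1
    have h2 := coe_residue_add (n := n) (v ((i : ℕ) : ℤ))
    rwa [h1, mul_zero, add_zero] at h2
  let σ : Perm (Fin n) :=
    { toFun := fun i => residue n (u ((i : ℕ) : ℤ))
      invFun := fun i => residue n (u⁻¹ ((i : ℕ) : ℤ))
      left_inv := fun i => by
        dsimp only
        rw [key u h, ← Perm.mul_apply, inv_mul_cancel, Perm.one_apply]
        simpa using residue_add_mul i 0
      right_inv := fun i => by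
        dsimp only
        rw [key u⁻¹ h', ← Perm.mul_apply, mul_inv_cancel, Perm.one_apply]
        simpa using residue_add_mul i 0 }
  have hσ : ∀ i, ((σ i : ℕ) : ℤ) = u ((i : ℕ) : ℤ) := fun i => key u h i
  refine ⟨σ, ?_, fun i => ?_⟩
  · ext x
    rw [windowPerm_apply, hσ, ← hu.add_mul, coe_residue_add]
  · have h1 := congrArg Prod.snd (h ((i : ℕ) : ℤ))
    rwa [windowLevel_coe, ← hσ, windowLevel_coe] at h1

/-- The length series of a set of elements which come from permutations of the window. -/
theorem lengthSeries_eq_sum {A : Set W} {q : Perm (Fin n) → Prop} [DecidablePred q]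
    (hA : ∀ x ∈ A, ∃ σ : Perm (Fin n), toPerm cs x = windowPerm σ)
    (hq : ∀ x σ, toPerm cs x = windowPerm σ → (x ∈ A ↔ q σ)) :
    lengthSeries cs A = ∑ σ ∈ Finset.univ.filter q, (X : ℤ⟦X⟧) ^ invCount σ := by
  have hex : ∀ σ : Perm (Fin n), ∃ x : W, toPerm cs x = windowPerm σ := fun σ =>
    exists_toPerm_eq cs (isPeriodic_windowPerm σ) (displacement_windowPerm σ)
  choose g hg using hex
  ext m
  rw [lengthSeries, coeff_mk, map_sum]
  simp_rw [coeff_X_pow]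
  rw [Finset.sum_boole, Finset.filter_filter]
  congr 1
  rw [← Fintype.card_subtype, ← Nat.card_eq_fintype_card]
  refine (Nat.card_congr (Equiv.ofBijective
    (fun σ : {σ : Perm (Fin n) // q σ ∧ m = invCount σ} => (⟨g σ.1, (hq _ _ (hg σ.1)).2 σ.2.1, by
      rw [length_eq_invCount cs (hg σ.1)]; exact σ.2.2.symm⟩ :
        {w : W // w ∈ A ∧ cs.length w = m})) ?_)).symm
  constructor
  · intro σ τ h
    have h1 : g σ.1 = g τ.1 := congrArg Subtype.val h
    exact Subtype.ext (windowPerm_injective (by rw [← hg, ← hg, h1]))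
  · rintro ⟨x, hx, hm⟩
    obtain ⟨σ, hσ⟩ := hA x hx
    refine ⟨⟨σ, (hq x σ hσ).1 hx, by rw [← length_eq_invCount cs hσ, hm]⟩, Subtype.ext ?_⟩
    apply toPerm_injective cs
    change toPerm cs (g σ) = _
    rw [hg, hσ]

theorem windowLevel_windowPerm (c : Fin n → ℤ) (σ : Perm (Fin n)) :
    (∀ y, windowLevel c (windowPerm σ y) = windowLevel c y) ↔ ∀ i, c (σ i) = c i := by
  constructor
  · intro h i
    have h1 := congrArg Prod.snd (h ((i : ℕ) : ℤ))
    rwa [windowPerm_coe, windowLevel_coe, windowLevel_coe] at h1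
  · intro h y
    rw [← coe_residue_add (n := n) y, windowPerm_add_mul, windowLevel_add_mul, windowLevel_add_mul,
      h]

theorem poincareSeries_finiteGenerators :
    poincareSeries cs (finiteGenerators cs) = gaussFactorial X n := by
  have h0 : Monotone fun _ : Fin n => (0 : ℤ) := fun _ _ _ => le_rfl
  rw [poincareSeries, finiteGenerators_eq,
    lengthSeries_eq_sum cs (q := fun _ => True), Finset.filter_true, sum_pow_invCount,
    Fintype.card_fin]
  · intro x hx
    obtain ⟨σ, h, -⟩ := exists_windowPerm_eq (isPeriodic_toPerm cs x)
      ((mem_closure_levelGenerators_iff cs h0 x).1 hx)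
    exact ⟨σ, h⟩
  · intro x σ h
    rw [SetLike.mem_coe, mem_closure_levelGenerators_iff cs h0, h, windowLevel_windowPerm]
    simp

/-- Conjugation by a minimal involution maps a generator of the finite part to another one exactly
if it exchanges neighbours on the same level. -/
theorem interConj_eq_levelGenerators {w : W} (hw : w⁻¹ = w)
    (hmin : IsMinInvolution n (toPerm cs w)) :
    interConj (finiteGenerators cs) w = levelGenerators cs (level (toPerm cs w)) := by
  have hinv := hmin.involutive
  ext s
  constructor
  · rintro ⟨⟨i, hi, rfl⟩, t, ⟨i', hi', rfl⟩, ht⟩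
    rw [MulAut.conj_apply, hw] at ht
    let j : Fin n := ⟨(i.1 : ℕ) - 1, by have := i.1.2; omega⟩
    have hj : (i.1 : ℕ) = j + 1 := by simp only [j]; omega
    have hj' : ((i.1 : ℕ) : ℤ) - 1 = (j : ℕ) := by rw [hj]; push_cast; ring
    refine ⟨i, j, hj, ?_, rfl⟩
    have hlt := hmin.mono j i.1 (by rw [Fin.lt_def]; omega)
    have h1 : toPerm cs w ((j : ℕ) : ℤ) =
        swapFun ((i'.1 : ℕ) : ZMod n) (toPerm cs w ((i.1 : ℕ) : ℤ)) := by
      rw [← hj', ← swapFun_of_eq (n := n) (i := ((i.1 : ℕ) : ZMod n)) (by simp),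
        ← toPerm_mul_simple_apply, ← ht, ← mul_assoc, ← mul_assoc]
      nth_rewrite 1 [← hw]
      rw [inv_mul_cancel, one_mul, map_mul, Perm.mul_apply, toPerm_simple]
      rfl
    -- The image of `i` must be in the class of `i'`, hence not at the lower end of a window.
    have h2 : ((toPerm cs w ((i.1 : ℕ) : ℤ) : ℤ) : ZMod n) = ((i'.1 : ℕ) : ZMod n) := by
      by_contra hne
      rw [swapFun, if_neg hne] at h1
      split_ifs at h1 <;> omega
    obtain ⟨k, hk⟩ := exists_eq_add_mul (n := n) (x := ((i'.1 : ℕ) : ℤ)) (by rw [h2]; simp)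
    rw [swapFun_of_eq h2] at h1
    let j' : Fin n := ⟨(i'.1 : ℕ) - 1, by have := i'.1.2; omega⟩
    have hj'' : ((i'.1 : ℕ) : ℤ) - 1 = (j' : ℕ) := by
      have : (i'.1 : ℕ) = j' + 1 := by simp only [j']; omega
      rw [this]; push_cast; ring
    rw [level, level, h1, hk, show ((i'.1 : ℕ) : ℤ) + n * k - 1 = (j' : ℕ) + n * k by
      rw [← hj'']; ring, add_mul_ediv_of_fin, add_mul_ediv_of_fin]
  · rintro ⟨i, j, hij, h, rfl⟩
    refine ⟨⟨i, by omega, rfl⟩, ?_⟩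
    have h1 := hmin.apply_add_one hij h
    have hpi := partner_add_level (toPerm cs w) i.1
    have hpj := partner_add_level (toPerm cs w) j
    rw [h] at hpj
    have hpij : (partner (toPerm cs w) i.1 : ℕ) = partner (toPerm cs w) j + 1 := by omega
    refine ⟨cs.simple ⟨partner (toPerm cs w) i.1, i.2⟩, ⟨_, by simp only; omega, rfl⟩, ?_⟩
    rw [MulAut.conj_apply, hw]
    apply toPerm_injective cs
    ext y
    have hper := hmin.periodic
    have hz : ∀ y : ℤ, swapFun ((partner (toPerm cs w) i.1 : ℕ) : ZMod n) (toPerm cs w y) =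
        toPerm cs w (swapFun ((i.1 : ℕ) : ZMod n) y) := by
      intro y
      have hci : ((toPerm cs w ((i.1 : ℕ) : ℤ) : ℤ) : ZMod n) =
          ((partner (toPerm cs w) i.1 : ℕ) : ZMod n) := by
        rw [hpi]; push_cast; simp
      by_cases hy : (y : ZMod n) = ((i.1 : ℕ) : ZMod n)
      · obtain ⟨k, rfl⟩ := exists_eq_add_mul (n := n) (x := ((i.1 : ℕ) : ℤ)) (y := y)
          (by rw [hy]; simp)
        rw [swapFun_of_eq hy, swapFun_of_eq (by rw [hper.add_mul]; push_cast; rw [hci]; simp),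
          show ((i.1 : ℕ) : ℤ) + n * k - 1 = (j : ℕ) + n * k by rw [hij]; push_cast; ring,
          hper.add_mul, hper.add_mul, h1]
        ring
      · by_cases hy' : (y : ZMod n) + 1 = ((i.1 : ℕ) : ZMod n)
        · obtain ⟨k, rfl⟩ := exists_eq_add_mul (n := n) (x := ((j : ℕ) : ℤ)) (y := y) (by
            rw [eq_comm, ← add_left_inj 1, hy', hij]; simp)
          rw [swapFun_of_add_one_eq i.2 hy', show ((j : ℕ) : ℤ) + n * k + 1 = (i.1 : ℕ) + n * k by
            rw [hij]; push_cast; ring, hper.add_mul, hper.add_mul, h1,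
            swapFun_of_add_one_eq i.2]
          · ring
          · rw [← hci, h1]
            push_cast
            simp
        · rw [swapFun_of_ne hy hy', swapFun_of_ne]
          · rw [← hci]
            intro h'
            exact hy (by simpa using hper.cast_injective h')
          · rw [← hci, h1]
            intro h'
            push_cast at h'
            have h'' := hper.cast_injective (add_right_cancel h')
            apply hy'
            rw [h'', hij]
            simp
    rw [map_mul, map_mul, Perm.mul_apply, Perm.mul_apply, toPerm_simple, toPerm_simple,
      affineSwap_apply, affineSwap_apply]
    change toPerm cs w (swapFun ((partner (toPerm cs w) i.1 : ℕ) : ZMod n) (toPerm cs w y)) = _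
    rw [hz, hinv]

/-- The fixed point series attached to a minimal involution. -/
theorem fixedSeries_eq {w : W} (hw : w⁻¹ = w) (hmin : IsMinInvolution n (toPerm cs w)) {N : ℕ}
    (hN : ∀ i : Fin n, -(N : ℤ) - 1 < level (toPerm cs w) i ∧ level (toPerm cs w) i < N + 1) :
    fixedSeries cs (interConj (finiteGenerators cs) w) (MulAut.conj w) =
      gaussFactorial X (n - 2 * IsMinInvolution.profile n (toPerm cs w) 0) *
        ∏ j ∈ Finset.range N, gaussFactorial (X ^ 2)
          (IsMinInvolution.profile n (toPerm cs w) j -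
            IsMinInvolution.profile n (toPerm cs w) (j + 1)) := by
  classical
  have hinv := hmin.involutive
  have hper := hmin.periodic
  rw [fixedSeries, interConj_eq_levelGenerators cs hw hmin,
    lengthSeries_eq_sum cs (q := BlockPerm n (toPerm cs w)), hmin.sum_blockPerm _ hN,
    hmin.card_block_zero]
  · simp_rw [hmin.card_block_succ]
  · intro x hx
    obtain ⟨σ, h, -⟩ := exists_windowPerm_eq (isPeriodic_toPerm cs x)
      ((mem_closure_levelGenerators_iff cs hmin.level_mono x).1 hx.1)
    exact ⟨σ, h⟩
  · intro x σ h
    rw [Set.mem_ofPred_eq, mem_closure_levelGenerators_iff cs hmin.level_mono, h,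
      windowLevel_windowPerm, BlockPerm]
    refine and_congr_right fun hσ => ?_
    have h1 : MulAut.conj w x = x ↔ ∀ y, windowPerm σ (toPerm cs w y) =
        toPerm cs w (windowPerm σ y) := by
      rw [MulAut.conj_apply, mul_inv_eq_iff_eq_mul, ← (toPerm_injective cs).eq_iff, map_mul,
        map_mul, h, Equiv.ext_iff]
      exact forall_congr' fun y => eq_comm
    rw [h1]
    constructor
    · intro h2 i
      have h3 := h2 ((i : ℕ) : ℤ)
      rw [windowPerm_coe, partner_add_level, windowPerm_add_mul, partner_add_level _ (σ i),
        hσ] at h3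
      apply Fin.ext
      have := add_right_cancel h3
      exact_mod_cast this
    · intro h2 y
      rw [← coe_residue_add (n := n) y, hper.add_mul, windowPerm_add_mul, hper.add_mul,
        partner_add_level, partner_add_level _ (σ _), hσ, ← h2, add_assoc, ← mul_add,
        windowPerm_add_mul, mul_add, add_assoc]

end Parabolic

/-! ### A `q`-binomial identity -/

section QIdentity

variable {R : Type*} [CommRing R]

/-- The product `(1 - p) (1 - p ^ 2) ⋯ (1 - p ^ m)`. -/
def eulerProd (p : R) (m : ℕ) : R := ∏ i ∈ Finset.range m, (1 - p ^ (i + 1))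

/-- The product `(1 - x) (1 - x p) ⋯ (1 - x p ^ (m - 1))`. -/
def shiftedProd (x p : R) (m : ℕ) : R := ∏ i ∈ Finset.range m, (1 - x * p ^ i)

theorem eulerProd_succ (p : R) (m : ℕ) : eulerProd p (m + 1) = eulerProd p m * (1 - p ^ (m + 1)) :=
  Finset.prod_range_succ _ _

theorem eulerProd_zero (p : R) : eulerProd p 0 = 1 := Finset.prod_range_zero _

theorem shiftedProd_succ (x p : R) (m : ℕ) :
    shiftedProd x p (m + 1) = shiftedProd x p m * (1 - x * p ^ m) :=
  Finset.prod_range_succ _ _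

theorem eulerProd_add (p : R) (m c : ℕ) :
    eulerProd p (m + c) = eulerProd p m * shiftedProd (p ^ (m + 1)) p c := by
  rw [eulerProd, Finset.prod_range_add, eulerProd, shiftedProd]
  congr 1
  refine Finset.prod_congr rfl fun i _ => ?_
  rw [← pow_add]
  congr 2
  ring

theorem gaussFactorial_mul_pow (p : R) (m : ℕ) :
    gaussFactorial p m * (1 - p) ^ m = eulerProd p m := by
  rw [gaussFactorial, eulerProd, ← Finset.card_range m, ← Finset.prod_const, Finset.card_range,
    ← Finset.prod_mul_distrib]
  exact Finset.prod_congr rfl fun i _ => geom_sum_mul_neg p (i + 1)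

/-- The `q`-binomial coefficient `[b + c choose b]`, as a polynomial in `p`. -/
def gaussBinom (p : R) : ℕ → ℕ → R
  | 0, _ => 1
  | _ + 1, 0 => 1
  | b + 1, c + 1 => gaussBinom p (b + 1) c + p ^ (c + 1) * gaussBinom p b (c + 1)

theorem gaussBinom_zero_left (p : R) (c : ℕ) : gaussBinom p 0 c = 1 := by
  rw [gaussBinom]

theorem gaussBinom_zero_right (p : R) (b : ℕ) : gaussBinom p b 0 = 1 := by
  cases b <;> rw [gaussBinom]

theorem gaussBinom_mul (p : R) (b c : ℕ) :
    gaussBinom p b c * (eulerProd p b * eulerProd p c) = eulerProd p (b + c) := by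
  induction b generalizing c with
  | zero => rw [gaussBinom_zero_left, eulerProd_zero, zero_add]; ring
  | succ b ihb =>
    induction c with
    | zero => rw [gaussBinom_zero_right, eulerProd_zero, add_zero]; ring
    | succ c ihc =>
      have h1 := ihb (c + 1)
      rw [show b + (c + 1) = b + 1 + c by ring] at h1
      rw [gaussBinom, ← add_assoc, eulerProd_succ p (b + 1 + c)]
      rw [eulerProd_succ p c] at h1 ⊢
      rw [eulerProd_succ p b] at ihc ⊢
      linear_combination (1 - p ^ (c + 1)) * ihc + p ^ (c + 1) * (1 - p ^ (b + 1)) * h1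

/-- The `q`-Chu-Vandermonde type identity which solves the recursion for the generating functions
of profiles. -/
theorem sum_gaussBinom_mul_shiftedProd (x p : R) (k : ℕ) :
    ∑ y ∈ Finset.HasAntidiagonal.antidiagonal k,
      gaussBinom p y.1 y.2 * x ^ y.1 * shiftedProd x p y.2 = 1 := by
  induction k with
  | zero => simp [gaussBinom, shiftedProd]
  | succ k ih =>
    let f : ℕ × ℕ → R := fun y =>
      match y.2 with
      | 0 => 0
      | c + 1 => gaussBinom p y.1 c * x ^ y.1 * shiftedProd x p (c + 1)
    let g : ℕ × ℕ → R := fun y =>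
      match y.1 with
      | 0 => 0
      | b + 1 => p ^ y.2 * gaussBinom p b y.2 * x ^ (b + 1) * shiftedProd x p y.2
    have h : ∀ y ∈ Finset.HasAntidiagonal.antidiagonal (k + 1),
        gaussBinom p y.1 y.2 * x ^ y.1 * shiftedProd x p y.2 = f y + g y := by
      rintro ⟨_ | b, _ | c⟩ hy
      · simp at hy
      · simp [f, g, gaussBinom_zero_left]
      · simp [f, g, gaussBinom_zero_right]
      · simp only [f, g, gaussBinom]
        ring
    rw [Finset.sum_congr rfl h, Finset.sum_add_distrib, Finset.Nat.sum_antidiagonal_succ',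
      Finset.Nat.sum_antidiagonal_succ]
    simp only [f, g, zero_add]
    rw [← Finset.sum_add_distrib, ← ih]
    refine Finset.sum_congr rfl fun y _ => ?_
    rw [shiftedProd_succ]
    ring

end QIdentity

/-! ### The generating function of profiles -/

section ProfileSum

theorem isUnit_eulerProd {p : ℤ⟦X⟧} (hp : constantCoeff p = 0) (m : ℕ) :
    IsUnit (eulerProd p m) := by
  rw [isUnit_iff_constantCoeff, eulerProd, map_prod]
  simp [hp]

theorem isUnit_gaussFactorial {p : ℤ⟦X⟧} (hp : constantCoeff p = 0) (m : ℕ) :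
    IsUnit (gaussFactorial p m) :=
  isUnit_of_mul_isUnit_left (by
    rw [gaussFactorial_mul_pow]
    exact isUnit_eulerProd hp m)

theorem constantCoeff_X_sq : constantCoeff (X ^ 2 : ℤ⟦X⟧) = 0 := by simp

/-- The contribution of two consecutive terms `a ≥ b` of a profile. -/
noncomputable def stepWeight (n a b : ℕ) : ℤ⟦X⟧ :=
  X ^ (2 * ((n - a) * b)) * Ring.inverse (gaussFactorial (X ^ 2) (a - b))

theorem stepWeight_zero (n : ℕ) : stepWeight n 0 0 = 1 := by
  simp [stepWeight, gaussFactorial]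

/-- The weight of a profile. Since a profile is eventually zero, almost all factors are `1`. -/
noncomputable def profileWeight (n : ℕ) (r : ℕ → ℕ) : ℤ⟦X⟧ := ∏ᶠ j, stepWeight n (r j) (r (j + 1))

theorem profileWeight_eq_prod (n : ℕ) {r : ℕ → ℕ} (hr : Antitone r) {N : ℕ} (hN : r N = 0) :
    profileWeight n r = ∏ j ∈ Finset.range N, stepWeight n (r j) (r (j + 1)) := by
  refine finprod_eq_prod_of_mulSupport_subset _ fun j hj => ?_
  rw [Function.mem_mulSupport] at hj
  simp only [Finset.coe_range, Set.mem_Iio]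
  by_contra hcon
  have h1 : ∀ i, N ≤ i → r i = 0 := fun i hi => by
    have := hr hi
    omega
  rw [h1 j (not_lt.1 hcon), h1 (j + 1) (by omega), stepWeight_zero] at hj
  exact hj rfl

/-- Prepending a term to a profile. -/
def consProfile (k : ℕ) (r : ℕ → ℕ) : ℕ → ℕ
  | 0 => k
  | j + 1 => r j

theorem consProfile_mem {k i : ℕ} (hik : i ≤ k) {r : ℕ → ℕ} (hr : r ∈ profileSet i) :
    consProfile k r ∈ profileSet k := by
  obtain ⟨h1, h2, N, hN⟩ := hr
  refine ⟨antitone_nat_of_succ_le fun j => ?_, rfl, N + 1, hN⟩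
  cases j with
  | zero =>
    change r 0 ≤ k
    omega
  | succ j => exact h1 (Nat.le_succ j)

theorem profileWeight_consProfile (n : ℕ) {k i : ℕ} (hik : i ≤ k) {r : ℕ → ℕ}
    (hr : r ∈ profileSet i) :
    profileWeight n (consProfile k r) = stepWeight n k i * profileWeight n r := by
  have h := consProfile_mem hik hr
  obtain ⟨h1, h2, N, hN⟩ := hr
  rw [profileWeight_eq_prod n h.1 (N := N + 1) hN, profileWeight_eq_prod n h1 hN,
    Finset.prod_range_succ', mul_comm]
  congr 1
  change stepWeight n k (r 0) = _
  rw [h2]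

/-- Splitting off the first term of a profile. -/
def tailEquiv (k : ℕ) : (Σ i : Fin (k + 1), profileSet (i : ℕ)) ≃ profileSet k where
  toFun x := ⟨consProfile k x.2, consProfile_mem (by omega) x.2.2⟩
  invFun r := ⟨⟨(r : ℕ → ℕ) 1, by have := le_of_mem_profileSet r.2 1; omega⟩,
    ⟨fun j => (r : ℕ → ℕ) (j + 1), fun a b h => r.2.1 (by omega), rfl, by
      obtain ⟨N, hN⟩ := r.2.2.2
      have h := r.2.1 (Nat.le_succ N)
      rw [hN] at h
      exact ⟨N, Nat.le_zero.1 h⟩⟩⟩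
  left_inv := by
    rintro ⟨⟨i, hi⟩, r, hr⟩
    obtain rfl : r 0 = i := hr.2.1
    rfl
  right_inv := by
    rintro ⟨r, hr⟩
    apply Subtype.ext
    funext j
    cases j with
    | zero => exact hr.2.1.symm
    | succ j => rfl

theorem tsum_profileWeight_zero (n : ℕ) :
    ∑' r : profileSet 0, profileWeight n r = 1 := by
  have h : ∀ r : profileSet 0, (r : ℕ → ℕ) = fun _ => 0 := fun r => by
    funext j
    have := le_of_mem_profileSet r.2 j
    omega
  have hmem : (fun _ => 0 : ℕ → ℕ) ∈ profileSet 0 := ⟨fun _ _ _ => le_rfl, rfl, 0, rfl⟩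
  rw [tsum_eq_single (⟨_, hmem⟩ : profileSet 0) fun r hr => absurd (Subtype.ext (h r)) hr,
    profileWeight_eq_prod n hmem.1 (N := 0) rfl, Finset.prod_range_zero]

theorem tsum_eq_sum_mul_tsum {m : ℕ} {ι : Fin m → Type*} {β : Type*} (e : (Σ i, ι i) ≃ β)
    {f : β → ℤ⟦X⟧} {g : ∀ i, ι i → ℤ⟦X⟧} {c : Fin m → ℤ⟦X⟧}
    (h : ∀ x, f (e x) = c x.1 * g x.1 x.2) (hf : Summable f) (hg : ∀ i, Summable (g i)) :
    ∑' b, f b = ∑ i, c i * ∑' x, g i x := by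
  have h2 := e.summable_iff.2 hf
  rw [show f ∘ e = fun x => c x.1 * g x.1 x.2 from funext h] at h2
  have h3 : ∀ i, Summable fun x => c i * g i x := fun i => (hg i).mul_left _
  have h4 : ∑' x : Σ i, ι i, c x.1 * g x.1 x.2 = ∑ i, ∑' x, c i * g i x := by
    rw [h2.tsum_sigma' h3, tsum_fintype]
  rw [← e.tsum_eq, tsum_congr h, h4]
  exact Finset.sum_congr rfl fun i _ => (hg i).tsum_mul_left _

/-- The recursion for the generating functions of profiles, by splitting off the first term. -/
theorem tsum_profileWeight_eq (n k : ℕ)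
    (hs : ∀ i ≤ k, Summable fun r : profileSet i => profileWeight n r) :
    ∑' r : profileSet k, profileWeight n r =
      ∑ i ∈ Finset.range (k + 1), stepWeight n k i * ∑' r : profileSet i, profileWeight n r := by
  rw [← Fin.sum_univ_eq_sum_range fun i =>
    stepWeight n k i * ∑' r : profileSet i, profileWeight n r]
  exact tsum_eq_sum_mul_tsum (tailEquiv k)
    (g := fun i (r : profileSet (i : ℕ)) => profileWeight n r)
    (c := fun i => stepWeight n k i)
    (fun x => profileWeight_consProfile n (Nat.lt_succ_iff.1 x.1.2) x.2.2) (hs k le_rfl)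
    fun i => hs i (Nat.lt_succ_iff.1 i.2)

theorem stepWeight_mul_eulerProd (n a b : ℕ) :
    stepWeight n a b * eulerProd (X ^ 2) (a - b) =
      ((X ^ 2 : ℤ⟦X⟧) ^ (n - a)) ^ b * (1 - X ^ 2) ^ (a - b) := by
  rw [stepWeight, ← gaussFactorial_mul_pow, mul_assoc, ← mul_assoc (Ring.inverse _),
    Ring.inverse_mul_cancel _ (isUnit_gaussFactorial constantCoeff_X_sq _), one_mul, ← pow_mul,
    ← pow_mul]

/-- The closed form of the generating function of profiles. -/
theorem tsum_profileWeight_mul (n k : ℕ) (hn : 0 < n) (hk : k ≤ n / 2)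
    (hs : ∀ i ≤ k, Summable fun r : profileSet i => profileWeight n r) :
    (∑' r : profileSet k, profileWeight n r) *
        (eulerProd (X ^ 2) k * eulerProd (X ^ 2) (n - 1)) =
      (1 - X ^ 2) ^ k * eulerProd (X ^ 2) (n - 1 - k) := by
  induction k using Nat.strong_induction_on with
  | _ k ih =>
  rcases Nat.eq_zero_or_pos k with rfl | hk0
  · rw [tsum_profileWeight_zero, eulerProd_zero]
    simp
  set C : ℕ → ℤ⟦X⟧ := fun i => ∑' r : profileSet i, profileWeight n r with hC
  set p : ℤ⟦X⟧ := X ^ 2 with hp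
  set x : ℤ⟦X⟧ := p ^ (n - k) with hx
  have hrec : C k = ∑ i ∈ Finset.range (k + 1), stepWeight n k i * C i :=
    tsum_profileWeight_eq n k hs
  change C k * (eulerProd p k * eulerProd p (n - 1)) = (1 - p) ^ k * eulerProd p (n - 1 - k)
  have hlow : ∀ i ∈ Finset.range k,
      stepWeight n k i * C i * (eulerProd p k * eulerProd p (n - 1)) =
        (1 - p) ^ k * eulerProd p (n - 1 - k) *
          (gaussBinom p i (k - i) * x ^ i * shiftedProd x p (k - i)) := by
    intro i hi
    rw [Finset.mem_range] at hi
    have h1 : C i * (eulerProd p i * eulerProd p (n - 1)) =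
        (1 - p) ^ i * eulerProd p (n - 1 - i) :=
      ih i hi (by omega) fun j hj => hs j (by omega)
    have h2 := gaussBinom_mul p i (k - i)
    rw [show i + (k - i) = k by omega] at h2
    have h3 := stepWeight_mul_eulerProd n k i
    rw [← hp, ← hx] at h3
    have h4 := eulerProd_add p (n - 1 - k) (k - i)
    rw [show n - 1 - k + (k - i) = n - 1 - i by omega, show n - 1 - k + 1 = n - k by omega,
      ← hx] at h4
    have h5 : (1 - p) ^ k = (1 - p) ^ i * (1 - p) ^ (k - i) := by
      rw [← pow_add]
      congr 1
      omega
    rw [← h2, h5]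
    rw [h4] at h1
    linear_combination (stepWeight n k i * eulerProd p (k - i) * gaussBinom p i (k - i)) * h1 +
      ((1 - p) ^ i * eulerProd p (n - 1 - k) * shiftedProd x p (k - i) *
        gaussBinom p i (k - i)) * h3
  have hid := sum_gaussBinom_mul_shiftedProd x p k
  rw [Finset.Nat.sum_antidiagonal_eq_sum_range_succ_mk, Finset.sum_range_succ] at hid
  simp only [Nat.sub_self, gaussBinom_zero_right, shiftedProd, Finset.prod_range_zero, mul_one,
    one_mul] at hid
  have hdiag : stepWeight n k k = x ^ k := by
    have h := stepWeight_mul_eulerProd n k k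
    rwa [Nat.sub_self, eulerProd_zero, pow_zero, mul_one, mul_one, ← hp, ← hx] at h
  rw [Finset.sum_range_succ, hdiag] at hrec
  have hsum : (∑ i ∈ Finset.range k, stepWeight n k i * C i) *
      (eulerProd p k * eulerProd p (n - 1)) =
      (1 - p) ^ k * eulerProd p (n - 1 - k) * (1 - x ^ k) := by
    rw [Finset.sum_mul, Finset.sum_congr rfl hlow, ← Finset.mul_sum]
    congr 1
    exact eq_sub_of_add_eq hid
  -- The diagonal term of the recursion is not `1`, so that the recursion determines `C k`.
  have hne : (1 : ℤ⟦X⟧) - x ^ k ≠ 0 := by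
    intro h
    have h' := congrArg constantCoeff h
    rw [map_sub, map_pow, hx, hp, map_pow, map_pow, constantCoeff_X, zero_pow (by norm_num),
      zero_pow (by omega : n - k ≠ 0), zero_pow hk0.ne'] at h'
    simp at h'
  apply mul_right_cancel₀ hne
  rw [← hsum]
  linear_combination (eulerProd p k * eulerProd p (n - 1)) * hrec

theorem summable_of_dvd {ι : Type*} (f : ι → ℤ⟦X⟧) (e : ι → ℕ) (hdvd : ∀ i, X ^ e i ∣ f i)
    (hfin : ∀ d, {i | e i ≤ d}.Finite) : Summable f := by
  rw [WithPiTopology.summable_iff_summable_coeff]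
  intro d
  apply summable_of_hasFiniteSupport
  refine (hfin d).subset fun i hi => ?_
  rw [Function.mem_support] at hi
  by_contra hcon
  exact hi (X_pow_dvd_iff.1 (hdvd i) d (not_le.1 hcon))

end ProfileSum

/-! ### The sum over minimal involutions -/

section MinimalInvolutionSum

theorem ringInverse_eq_of_mul_eq_one {M : Type*} [CommRing M] {a b : M} (h : a * b = 1) :
    Ring.inverse a = b := by
  have hu : IsUnit a := isUnit_of_mul_isUnit_left (by rw [h]; exact isUnit_one)
  rw [← mul_one (Ring.inverse a), ← h, ← mul_assoc, Ring.inverse_mul_cancel _ hu, one_mul]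

theorem subst_gaussFactorial (n : ℕ) :
    PowerSeries.subst (X ^ 2 : ℤ⟦X⟧) (gaussFactorial (X : ℤ⟦X⟧) n) = gaussFactorial (X ^ 2) n := by
  have hs : HasSubst (X ^ 2 : ℤ⟦X⟧) := HasSubst.X_pow (by norm_num)
  rw [← coe_substAlgHom hs, gaussFactorial, map_prod, gaussFactorial]
  refine Finset.prod_congr rfl fun i _ => ?_
  rw [map_sum]
  refine Finset.sum_congr rfl fun l _ => ?_
  rw [map_pow, substAlgHom_X hs]

variable {n : ℕ} [NeZero n] {W : Type*} [Group W] (cs : CoxeterSystem (affineMatrix n) W)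

omit [NeZero n] in
theorem prod_stepWeight (r : ℕ → ℕ) (N : ℕ) :
    ∏ j ∈ Finset.range N, stepWeight n (r j) (r (j + 1)) =
      X ^ (∑ j ∈ Finset.range N, 2 * ((n - r j) * r (j + 1))) *
        ∏ j ∈ Finset.range N, Ring.inverse (gaussFactorial (X ^ 2) (r j - r (j + 1))) := by
  simp only [stepWeight]
  rw [Finset.prod_mul_distrib, Finset.prod_pow_eq_pow_sum]

/-- The term of a minimal involution, in terms of its profile. The divisibility makes the family of
weights summable. -/
theorem cosetTerm_eq {w : W} (hw : w⁻¹ = w)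
    (hw' : w ∈ minCosetReps cs (finiteGenerators cs)) {r : ℕ → ℕ}
    (hr : IsMinInvolution.profile n (toPerm cs w) = r) :
    r 0 ^ 2 ≤ cs.length w ∧ X ^ (cs.length w - r 0 ^ 2) ∣ profileWeight n r ∧
    cosetTerm cs (finiteGenerators cs) w =
      X ^ (r 0 ^ 2) * gaussFactorial (X ^ 2) n * Ring.inverse (gaussFactorial X (n - 2 * r 0)) *
        profileWeight n r := by
  have hmin := isMinInvolution_toPerm cs hw hw'
  obtain ⟨N, hN⟩ := IsMinInvolution.exists_level_bound (n := n) (toPerm cs w)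
  have hN' : ∀ i : Fin n, -(N : ℤ) - 1 < level (toPerm cs w) i ∧ level (toPerm cs w) i < N + 1 :=
    fun i => by
      have := hN i
      omega
  have hrN : r N = 0 := by
    rw [← hr, IsMinInvolution.profile, IsMinInvolution.levelCount, Finset.card_eq_zero,
      Finset.filter_eq_empty_iff]
    intro i _
    have := (hN i).1
    omega
  have hanti : Antitone r := hr ▸ IsMinInvolution.profile_antitone
  have hle : ∀ j, r j ≤ n := fun j => by
    rw [← hr]
    unfold IsMinInvolution.profile IsMinInvolution.levelCount
    exact (Finset.card_le_univ _).trans (Fintype.card_fin n).le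
  have hlen : cs.length w = r 0 ^ 2 + ∑ j ∈ Finset.range N, 2 * ((n - r j) * r (j + 1)) := by
    have h1 := two_mul_length cs w
    rw [hmin.shiSum_eq_profile N hN', hr] at h1
    zify
    rw [← Finset.mul_sum, Finset.sum_congr rfl fun j _ => by rw [Nat.cast_sub (hle j)]]
    linarith
  have hfix := fixedSeries_eq cs hw hmin hN'
  rw [hr] at hfix
  rw [profileWeight_eq_prod n hanti hrN, prod_stepWeight, hlen, Nat.add_sub_cancel_left]
  refine ⟨Nat.le_add_right _ _, Dvd.intro _ rfl, ?_⟩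
  have hinv : Ring.inverse (fixedSeries cs (interConj (finiteGenerators cs) w) (MulAut.conj w)) =
      Ring.inverse (gaussFactorial X (n - 2 * r 0)) *
        ∏ j ∈ Finset.range N, Ring.inverse (gaussFactorial (X ^ 2) (r j - r (j + 1))) := by
    apply ringInverse_eq_of_mul_eq_one
    rw [hfix, mul_mul_mul_comm, ← Finset.prod_mul_distrib,
      Ring.mul_inverse_cancel _ (isUnit_gaussFactorial constantCoeff_X _), one_mul]
    exact Finset.prod_eq_one fun j _ =>
      Ring.mul_inverse_cancel _ (isUnit_gaussFactorial constantCoeff_X_sq _)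
  rw [cosetTerm, poincareSeries_finiteGenerators, subst_gaussFactorial, hinv, hlen, pow_add]
  ring

/-- There are finitely many minimal involutions of each length, hence finitely many profiles of
each weight. -/
theorem summable_profileWeight {k : ℕ} (hk : k ≤ n / 2) :
    Summable fun r : profileSet k => profileWeight n r := by
  let cs : CoxeterSystem (affineMatrix n) (affineMatrix n).Group :=
    (affineMatrix n).toCoxeterSystem
  let w : profileSet k → (affineMatrix n).Group := fun r => ((profileEquiv cs hk).symm r).1.1
  have hr : ∀ r, IsMinInvolution.profile n (toPerm cs (w r)) = r := fun r => by
    rw [← profileEquiv_apply cs hk, Equiv.apply_symm_apply]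
  have hinj : Function.Injective w := fun r s h => Subtype.ext (by rw [← hr r, h, hr s])
  have hterm := fun r : profileSet k => cosetTerm_eq cs ((profileEquiv cs hk).symm r).1.2
    ((profileEquiv cs hk).symm r).2.1 (hr r)
  refine summable_of_dvd _ (fun r => cs.length (w r) - (r : ℕ → ℕ) 0 ^ 2)
    (fun r => (hterm r).2.1) fun d => ?_
  have hfin : (⋃ m ∈ Finset.range (d + k ^ 2 + 1), {v | cs.length v = m}).Finite :=
    Set.Finite.biUnion (Finset.finite_toSet _) fun m _ => finite_length_eq cs m
  refine (hfin.preimage hinj.injOn).subset fun r hd => ?_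
  have h1 : cs.length (w r) - (r : ℕ → ℕ) 0 ^ 2 ≤ d := hd
  rw [r.2.2.1] at h1
  simp only [Set.mem_preimage, Set.mem_iUnion]
  exact ⟨cs.length (w r), Finset.mem_range.2 (by omega), rfl⟩

end MinimalInvolutionSum

/-! ### The closed form -/

section ClosedForm

/-- The product `(1 + q) (1 + q ^ 2) ⋯ (1 + q ^ m)`. -/
noncomputable def plusProd (m : ℕ) : ℤ⟦X⟧ := ∏ i ∈ Finset.range m, (1 + X ^ (i + 1))

theorem eulerProd_X_sq (m : ℕ) : eulerProd (X ^ 2 : ℤ⟦X⟧) m = eulerProd X m * plusProd m := by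
  rw [eulerProd, eulerProd, plusProd, ← Finset.prod_mul_distrib]
  exact Finset.prod_congr rfl fun i _ => by ring

theorem isUnit_plusProd (m : ℕ) : IsUnit (plusProd m) := by
  rw [isUnit_iff_constantCoeff, plusProd, map_prod]
  simp

theorem isUnit_one_sub_X_pow {m : ℕ} (hm : m ≠ 0) : IsUnit (1 - X ^ m : ℤ⟦X⟧) := by
  rw [isUnit_iff_constantCoeff]
  simp [hm]

theorem isUnit_one_add_X_pow {m : ℕ} (hm : m ≠ 0) : IsUnit (1 + X ^ m : ℤ⟦X⟧) := by
  rw [isUnit_iff_constantCoeff]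
  simp [hm]

theorem isUnit_one_sub_X : IsUnit (1 - X : ℤ⟦X⟧) := by
  simpa using isUnit_one_sub_X_pow one_ne_zero

theorem isUnit_one_add_X : IsUnit (1 + X : ℤ⟦X⟧) := by
  simpa using isUnit_one_add_X_pow one_ne_zero

theorem qNum_mul (m : ℕ) : qNum m * (1 - X) = 1 - X ^ m := by
  rw [qNum, mul_assoc, Ring.inverse_mul_cancel _ isUnit_one_sub_X, mul_one]

theorem qFactorial_mul (m : ℕ) : qFactorial m * (1 - X) ^ m = eulerProd X m := by
  induction m with
  | zero => simp [qFactorial, eulerProd]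
  | succ m ih =>
    rw [qFactorial, Finset.prod_Icc_succ_top (by omega), eulerProd_succ, ← ih, ← qNum_mul,
      qFactorial]
    ring

theorem plusProd_mul_qPochhammer (k d : ℕ) :
    plusProd k * qPochhammer (-X ^ (k + 1)) d = plusProd (k + d) := by
  rw [plusProd, plusProd, qPochhammer, Finset.prod_range_add]
  congr 1
  exact Finset.prod_congr rfl fun i _ => by ring

theorem map_ringInverse_eq_inv {A K : Type*} [CommRing A] [Field K] (f : A →+* K) {u : A}
    (hu : IsUnit u) : f (Ring.inverse u) = (f u)⁻¹ := by
  apply eq_inv_of_mul_eq_one_left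
  rw [← map_mul, Ring.inverse_mul_cancel _ hu, map_one]

/-- The algebra behind the closed form. The variables `E_` and `F_` stand for the products of the
`1 - q ^ i` and of the `1 + q ^ i`, with `l = n - 1`, `m = n - 1 - k` and `d = n - 2 * k`; moreover
`s = 1 - q`, `t = 1 + q`, `u = 1 - q ^ n`, `v = 1 + q ^ n`, `b = 1 - q ^ (m + 1)` and
`b' = 1 + q ^ (m + 1)`, and the equations express the remaining variables through these. -/
theorem field_identity {K : Type*} [Field K] {n k d m : ℕ} (hd : n = 2 * k + d)
    (hmd : m + 1 = k + d) {s t g h c N N' Q Qk Qd P El Em Ek Ed Fl Fm Fk u v b b' y : K}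
    (hEl : El ≠ 0) (hEm : Em ≠ 0) (hEk : Ek ≠ 0) (hEd : Ed ≠ 0) (hFl : Fl ≠ 0) (hFm : Fm ≠ 0)
    (hFk : Fk ≠ 0) (hs : s ≠ 0) (ht : t ≠ 0) (hb : b ≠ 0) (hb' : b' ≠ 0)
    (g1 : g * (s * t) ^ n = El * Fl * (u * v)) (g2 : h * s ^ d = Ed) (g3 : N * s = u)
    (g4 : N' * s = b * b') (g5 : Q * s ^ (m + 1) = Em * b) (g6 : Qk * s ^ k = Ek)
    (g7 : Qd * s ^ d = Ed) (g8 : Fk * P = Fm * b')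
    (hC : c * (Ek * Fk * (El * Fl)) = (s * t) ^ k * (Em * Fm)) :
    y * g * h⁻¹ * c = y * (N * N'⁻¹) * (Q * (Qk * Qd)⁻¹) * P * (t * s⁻¹) ^ k *
      (v * (t ^ n)⁻¹) := by
  have hsd : s ^ d ≠ 0 := pow_ne_zero _ hs
  have hsk : s ^ k ≠ 0 := pow_ne_zero _ hs
  have htk : t ^ k ≠ 0 := pow_ne_zero _ ht
  have htd : t ^ d ≠ 0 := pow_ne_zero _ ht
  subst hd
  rw [hmd, pow_add] at g5
  rw [mul_pow, pow_add, pow_add, pow_mul', pow_mul'] at g1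
  rw [mul_pow] at hC
  rw [mul_pow, inv_pow, pow_add, pow_mul']
  generalize s ^ k = S at *
  generalize s ^ d = D at *
  generalize t ^ k = T at *
  generalize t ^ d = D' at *
  have hden : S ^ 2 * D * (T ^ 2 * D') ≠ 0 :=
    mul_ne_zero (mul_ne_zero (pow_ne_zero _ hsk) hsd) (mul_ne_zero (pow_ne_zero _ htk) htd)
  obtain rfl := eq_div_of_mul_eq hden g1
  obtain rfl := eq_div_of_mul_eq hsd g2
  obtain rfl := eq_div_of_mul_eq hs g3
  obtain rfl := eq_div_of_mul_eq hs g4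
  obtain rfl := eq_div_of_mul_eq (mul_ne_zero hsk hsd) g5
  obtain rfl := eq_div_of_mul_eq hsk g6
  obtain rfl := eq_div_of_mul_eq hsd g7
  obtain rfl := eq_div_of_mul_eq hFk ((mul_comm _ _).trans g8)
  obtain rfl := eq_div_of_mul_eq (mul_ne_zero (mul_ne_zero hEk hFk) (mul_ne_zero hEl hFl)) hC
  field_simp

/-- The closed form of the sum, by comparing both sides in the fraction field of `ℤ⟦X⟧`. -/
theorem closedForm_eq {n k : ℕ} (hn : 0 < n) (hk : k ≤ n / 2) {C : ℤ⟦X⟧}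
    (hC : C * (eulerProd (X ^ 2) k * eulerProd (X ^ 2) (n - 1)) =
      (1 - X ^ 2) ^ k * eulerProd (X ^ 2) (n - 1 - k)) :
    X ^ (k ^ 2) * gaussFactorial (X ^ 2) n * Ring.inverse (gaussFactorial X (n - 2 * k)) * C =
      X ^ (k ^ 2) * (qNum n * Ring.inverse (qNum (2 * n - 2 * k))) * qBinom (n - k) k *
        qPochhammer (-X ^ (k + 1)) (n - 2 * k) * ((1 + X) * Ring.inverse (1 - X)) ^ k *
        ((1 + X ^ n) * Ring.inverse ((1 + X) ^ n)) := by
  obtain ⟨m, hm⟩ : ∃ m, n - k = m + 1 := ⟨n - k - 1, by omega⟩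
  obtain ⟨l, hl⟩ : ∃ l, n = l + 1 := ⟨n - 1, by omega⟩
  obtain ⟨d, hd⟩ : ∃ d, n = 2 * k + d := ⟨n - 2 * k, by omega⟩
  have hmd : m + 1 = k + d := by omega
  have hn1 : n - 1 = l := by omega
  have hn2 : n - 1 - k = m := by omega
  have hn3 : n - 2 * k = d := by omega
  have hn4 : n - k - k = d := by omega
  have hn5 : 2 * n - 2 * k = 2 * (m + 1) := by omega
  rw [hn2, hn1] at hC
  rw [qBinom, hn3, hn4, hn5, hm]
  have g1 := gaussFactorial_mul_pow (X ^ 2 : ℤ⟦X⟧) n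
  have g2 := gaussFactorial_mul_pow (X : ℤ⟦X⟧) d
  have g3 := qNum_mul n
  have g4 := qNum_mul (2 * (m + 1))
  have g5 := qFactorial_mul (m + 1)
  have g6 := qFactorial_mul k
  have g7 := qFactorial_mul d
  have g8 := plusProd_mul_qPochhammer k d
  have e1 : eulerProd (X ^ 2 : ℤ⟦X⟧) n = eulerProd (X ^ 2) l * ((1 - X ^ n) * (1 + X ^ n)) := by
    rw [hl, eulerProd_succ]
    ring
  have e2 : plusProd (k + d) = plusProd m * (1 + X ^ (m + 1)) := by
    rw [← hmd, plusProd, Finset.prod_range_succ, ← plusProd]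
  have e3 : (1 - X ^ (2 * (m + 1)) : ℤ⟦X⟧) = (1 - X ^ (m + 1)) * (1 + X ^ (m + 1)) := by ring
  have e4 : (1 - X ^ 2 : ℤ⟦X⟧) = (1 - X) * (1 + X) := by ring
  rw [e1, e4, eulerProd_X_sq] at g1
  rw [eulerProd_succ] at g5
  rw [e2] at g8
  rw [e3] at g4
  rw [e4, eulerProd_X_sq, eulerProd_X_sq, eulerProd_X_sq] at hC
  have u1 := isUnit_gaussFactorial constantCoeff_X d
  have u2 : IsUnit (qNum (2 * (m + 1))) := isUnit_of_mul_isUnit_left (by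
    rw [qNum_mul]; exact isUnit_one_sub_X_pow (by omega))
  have u3 : ∀ j, IsUnit (qFactorial j) := fun j => isUnit_of_mul_isUnit_left (by
    rw [qFactorial_mul]; exact isUnit_eulerProd constantCoeff_X j)
  -- Both sides are now compared in the fraction field, with the products as indeterminates.
  let K := FractionRing ℤ⟦X⟧
  let f : ℤ⟦X⟧ →+* K := algebraMap ℤ⟦X⟧ K
  have hf : Function.Injective f := IsFractionRing.injective ℤ⟦X⟧ K
  have hne : ∀ {u : ℤ⟦X⟧}, IsUnit u → f u ≠ 0 := fun hu => (hu.map f).ne_zero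
  have n1 := hne (isUnit_eulerProd (constantCoeff_X (R := ℤ)) l)
  have n2 := hne (isUnit_eulerProd (constantCoeff_X (R := ℤ)) m)
  have n3 := hne (isUnit_eulerProd (constantCoeff_X (R := ℤ)) k)
  have n4 := hne (isUnit_eulerProd (constantCoeff_X (R := ℤ)) d)
  have n5 := hne (isUnit_plusProd l)
  have n6 := hne (isUnit_plusProd m)
  have n7 := hne (isUnit_plusProd k)
  have n8 := hne isUnit_one_sub_X
  have n9 := hne isUnit_one_add_X
  have n10 := hne (isUnit_one_sub_X_pow (Nat.succ_ne_zero m))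
  have n11 := hne (isUnit_one_add_X_pow (Nat.succ_ne_zero m))
  apply hf
  have m1 := map_ringInverse_eq_inv f u1
  have m2 := map_ringInverse_eq_inv f u2
  have m3 := map_ringInverse_eq_inv f ((u3 k).mul (u3 d))
  have m4 := map_ringInverse_eq_inv f isUnit_one_sub_X
  have m5 := map_ringInverse_eq_inv f (isUnit_one_add_X.pow n)
  simp only [map_mul, map_pow] at m1 m2 m3 m4 m5 ⊢
  rw [m1, m2, m3, m4, m5]
  replace hC := congrArg f hC
  replace g1 := congrArg f g1
  replace g2 := congrArg f g2
  replace g3 := congrArg f g3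
  replace g4 := congrArg f g4
  replace g5 := congrArg f g5
  replace g6 := congrArg f g6
  replace g7 := congrArg f g7
  replace g8 := congrArg f g8
  simp only [map_mul, map_pow f (1 - X), map_pow f ((1 - X) * (1 + X))]
    at hC g1 g2 g3 g4 g5 g6 g7 g8
  exact field_identity hd hmd n1 n2 n3 n4 n5 n6 n7 n8 n9 n10 n11 g1 g2 g3 g4 g5 g6 g7 g8 hC

end ClosedForm

end CoxeterInvolutions

theorem theorem2 (n k : ℕ) (hn : 0 < n) (hk : k ≤ n / 2)
    {W : Type*} [Group W] (cs : CoxeterSystem (CoxeterInvolutions.affineMatrix n) W) :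
    (∃! ell' : CoxeterInvolutions.involutions W → ℕ,
      CoxeterInvolutions.IsAbsoluteLength cs ell') ∧
    ∀ ell' : CoxeterInvolutions.involutions W → ℕ,
      CoxeterInvolutions.IsAbsoluteLength cs ell' →
      HasSum
        (fun w : {w : CoxeterInvolutions.involutions W //
            (w : W) ∈ CoxeterInvolutions.minCosetReps cs
              (CoxeterInvolutions.finiteGenerators cs) ∧ ell' w = k} =>
          CoxeterInvolutions.cosetTerm cs (CoxeterInvolutions.finiteGenerators cs) (w.1 : W))
        (X ^ (k ^ 2) *
          (CoxeterInvolutions.qNum n * Ring.inverse (CoxeterInvolutions.qNum (2 * n - 2 * k))) *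
          CoxeterInvolutions.qBinom (n - k) k *
          CoxeterInvolutions.qPochhammer (-X ^ (k + 1)) (n - 2 * k) *
          ((1 + X) * Ring.inverse (1 - X)) ^ k *
          ((1 + X ^ n) * Ring.inverse ((1 + X) ^ n)) : ℤ⟦X⟧) := by
  have hn0 : NeZero n := ⟨hn.ne'⟩
  have habs := CoxeterInvolutions.isAbsoluteLength_absoluteLength cs
  refine ⟨⟨_, habs, fun f hf => hf.unique cs habs⟩, fun ell' hell => ?_⟩
  obtain rfl := hell.unique cs habs
  have hs : ∀ i ≤ k, Summable fun r : CoxeterInvolutions.profileSet i =>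
      CoxeterInvolutions.profileWeight n r := fun i hi =>
    CoxeterInvolutions.summable_profileWeight (hi.trans hk)
  rw [← CoxeterInvolutions.closedForm_eq hn hk
    (CoxeterInvolutions.tsum_profileWeight_mul n k hn hk hs)]
  have h1 := (CoxeterInvolutions.profileEquiv cs hk).hasSum_iff.2 ((hs k le_rfl).hasSum.mul_left
    (X ^ (k ^ 2) * CoxeterInvolutions.gaussFactorial (X ^ 2) n *
      Ring.inverse (CoxeterInvolutions.gaussFactorial X (n - 2 * k))))
  have h2 : (fun w : {w : CoxeterInvolutions.involutions W //
        (w : W) ∈ CoxeterInvolutions.minCosetReps cs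
          (CoxeterInvolutions.finiteGenerators cs) ∧
        CoxeterInvolutions.absoluteLength cs w = k} =>
      CoxeterInvolutions.cosetTerm cs (CoxeterInvolutions.finiteGenerators cs) (w.1 : W)) =
      (fun r : CoxeterInvolutions.profileSet k =>
        X ^ (k ^ 2) * CoxeterInvolutions.gaussFactorial (X ^ 2) n *
          Ring.inverse (CoxeterInvolutions.gaussFactorial X (n - 2 * k)) *
          CoxeterInvolutions.profileWeight n r) ∘ CoxeterInvolutions.profileEquiv cs hk := by
    funext w
    have h3 := (CoxeterInvolutions.cosetTerm_eq cs w.1.2 w.2.1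
      (CoxeterInvolutions.profileEquiv_apply cs hk w).symm).2.2
    rwa [(CoxeterInvolutions.profileEquiv cs hk w).2.2.1] at h3
  rw [h2]
  exact h1
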